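/- **Setting.** Let $N\in\mathbb N$, $0\le N_d\le N$, $L_1,\dots,L_N>0$, $M=(m_{ij})\in\mathcal M_N(\mathbb R)$ and $p\in[1,\infty)$. For $i\le N_d$ let $0\le a_i<b_i\le L_i$ and let $\alpha_i\in L^\infty(\mathbb R,[0,1])$; for $i>N_d$ put $a_i=b_i=L_i$ and $\alpha_i\equiv1$. Let $\chi_i$ be the indicator function of $[a_i,b_i]$. Let $\mathsf X_p=\prod_{i=1}^N L^p(0,L_i)$ with norm $\big(\sum_i\|u_i\|_{L^p(0,L_i)}^p\big)^{1/p}$, let $$D(A)=\Big\{(u_1,\dots,u_N)\in\prod_{i=1}^N W^{1,p}(0,L_i)\;\Big|\;u_i(0)=\sum_{j=1}^N m_{ij}u_j(L_j)\ \ \forall i\Big\},\qquad A(u_1,\dots,u_N)=(-u_1',\dots,-u_N'),$$ and let $B_i(u_1,\dots,u_N)=(0,\dots,-\chi_iu_i,\dots,0)$ (in position $i$). Elements of $W^{1,p}(0,L_i)$ are evaluated at points of $[0,L_i]$ through their continuous representative. A *regular solution* with initial datum $z_0\in D(A)$ is a continuous $z=(u_1,\dots,u_N):[0,\infty)\to\mathsf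 X_p$ with $z(0)=z_0$ and $z(t)\in D(A)$ for all $t\ge0$, which is differentiable at almost every $t$, with $\dot z\in L^\infty_{\rm loc}([0,\infty),\mathsf X_p)$ and $z(t)=z(0)+\int_0^t\dot z(s)\,ds$ for all $t\ge 0$, and which satisfies $\dot z(t)=Az(t)+\sum_{i=1}^{N_d}\alpha_i(t)B_iz(t)$ for almost every $t\ge0$. That is, it solves $\partial_tu_i+\partial_xu_i+\alpha_i(t)\chi_i(x)u_i=0$, $u_i(t,0)=\sum_jm_{ij}u_j(t,L_j)$, $u_i(0,x)=u_{i,0}(x)$. For $\mathfrak n\in\mathbb N^N$ put $L(\mathfrak n)=\sum_in_iL_i$; let $\mathfrak N_j=\{\mathfrak n\in\mathbb N^N: n_j=0\}$, let $\mathbf 1_j$ be the $j$-th unit multi-index, and let $\{x\}_y=x-\lfloor x/y\rfloor y$ for $y>0$. **Theorem.** Let $z_0=(u_{1,0},\dots,u_{N,0})\in D(A)$ and let $z=(u_1,\dots,u_N)$ be the corresponding regular solution, i.e. any regular solution with initial datum $z_0$. Then, for all $i$, $t\ge0$ and $x\in[0,L_i]$, $$u_i(t,x)=\begin{cases}u_{i,0}(x-t)\,\exp\Big(-\int_{[0,t]\cap[t-x+a_i,\,t-x+b_i]}\alpha_i(s)\,ds\Big),&0\le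 t\le x,\\[1ex] u_i(t-x,0)\,\exp\Big(-\int_{[0,t]\cap[t-x+a_i,\,t-x+b_i]}\alpha_i(s)\,ds\Big),&t\ge x,\end{cases}$$ and, for all $i$ and $t\ge0$, $$u_i(t,0)=\sum_{j=1}^N\ \sum_{\substack{\mathfrak n\in\mathfrak N_j\\ L(\mathfrak n)\le t}}\vartheta^{(i)}_{j,\ \mathfrak n+\left\lfloor\frac{t-L(\mathfrak n)}{L_j}\right\rfloor\mathbf 1_j,\ L_j-\{t-L(\mathfrak n)\}_{L_j},\ t}\ u_{j,0}\big(L_j-\{t-L(\mathfrak n)\}_{L_j}\big),$$ where the inner sums are finite and the coefficients are defined recursively, for $i,j\in\{1,\dots,N\}$, $\mathfrak n\in\mathbb N^N$, $x\in[0,L_j]$ and $t\in\mathbb R$, by $$\vartheta^{(i)}_{j,\mathfrak n,x,t}=\varepsilon_{j,\mathfrak n,x,t}\,\vartheta^{(i)}_{j,\mathfrak n,L_j,t},\qquad \varepsilon_{j,\mathfrak n,x,t}=\exp\Big(-\int_{I_{j,\mathfrak n,x,t}}\alpha_j(s)\,ds\Big),$$ $$I_{j,\mathfrak n,x,t}=[\,t-L(\mathfrak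 n)-L_j+\max(x,a_j),\ t-L(\mathfrak n)-L_j+b_j\,]\quad(\text{empty if the endpoints are reversed}),$$ $$\vartheta^{(i)}_{j,\mathbf 0,L_j,t}=m_{ij},\qquad \vartheta^{(i)}_{j,\mathfrak n,L_j,t}=\sum_{\substack{1\le k\le N\\ n_k\ge1}}m_{kj}\,\vartheta^{(i)}_{k,\mathfrak n-\mathbf 1_k,0,t}\quad(\mathfrak n\ne\mathbf 0).$$ -/

import Mathlib

open MeasureTheory Set
open scoped ENNReal ContDiff

noncomputable section

/-- The data of a damped transport system on a network of `N` circles of lengths `L i`, coupled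
through the matrix `M`. The first `Nd` circles are damped on `[a i, b i]`, with activity `α i`
in `L^∞(ℝ, [0, 1])`. By convention `α i = 1` and `a i = b i = L i` on the other circles. -/
structure CircleNetwork (N : ℕ) where
  Nd : ℕ
  Nd_le : Nd ≤ N
  L : Fin N → ℝ
  L_pos : ∀ i, 0 < L i
  M : Matrix (Fin N) (Fin N) ℝ
  a : Fin N → ℝ
  b : Fin N → ℝ
  a_nonneg : ∀ i : Fin N, (i : ℕ) < Nd → 0 ≤ a i
  a_lt_b : ∀ i : Fin N, (i : ℕ) < Nd → a i < b i
  b_le : ∀ i : Fin N, (i : ℕ) < Nd → b i ≤ L i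
  a_undamped : ∀ i : Fin N, Nd ≤ (i : ℕ) → a i = L i
  b_undamped : ∀ i : Fin N, Nd ≤ (i : ℕ) → b i = L i
  α : Fin N → ℝ → ℝ
  α_meas : ∀ i, AEMeasurable (α i) volume
  α_mem : ∀ i, ∀ᵐ s ∂(volume : Measure ℝ), α i s ∈ Icc (0 : ℝ) 1
  α_undamped : ∀ i : Fin N, Nd ≤ (i : ℕ) → ∀ s, α i s = 1

/-- `g` is the weak derivative of `f` on the open interval `(0, ℓ)`. -/
def HasWeakDeriv (ℓ : ℝ) (f g : ℝ → ℝ) : Prop :=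
  ∀ φ : ℝ → ℝ, ContDiff ℝ ∞ φ → HasCompactSupport φ → tsupport φ ⊆ Ioo 0 ℓ →
    ∫ x in Ioo 0 ℓ, f x * deriv φ x = -∫ x in Ioo 0 ℓ, g x * φ x

open Classical in
/-- The representative of `f` that is continuous on `[0, ℓ]` (unique on `[0, ℓ]` when `0 < ℓ`);
zero if there is none. -/
def contRep (ℓ : ℝ) (f : ℝ → ℝ) : ℝ → ℝ :=
  if h : ∃ g : ℝ → ℝ, ContinuousOn g (Icc 0 ℓ) ∧ f =ᵐ[volume.restrict (Ioo 0 ℓ)] g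
  then h.choose else 0

open Classical in
/-- The weak derivative in `L^p(0, ℓ)` of `f ∈ W^{1,p}(0, ℓ)`; zero if `f` is not in this space. -/
def weakDeriv {p : ℝ≥0∞} {ℓ : ℝ} (f : Lp ℝ p (volume.restrict (Ioo 0 ℓ))) :
    Lp ℝ p (volume.restrict (Ioo 0 ℓ)) :=
  if h : ∃ g : Lp ℝ p (volume.restrict (Ioo 0 ℓ)), HasWeakDeriv ℓ f g then h.choose else 0

/-- The product of `f ∈ L^p(0, ℓ)` with the indicator function of `[a, b]`. -/
def mulIndicatorLp {p : ℝ≥0∞} {ℓ : ℝ} (a b : ℝ) (f : Lp ℝ p (volume.restrict (Ioo 0 ℓ))) :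
    Lp ℝ p (volume.restrict (Ioo 0 ℓ)) :=
  ((Lp.memLp f).indicator (measurableSet_Icc (a := a) (b := b))).toLp

namespace CircleNetwork

variable {N : ℕ} (S : CircleNetwork N)

/-- The Banach space `X_p = ∏ᵢ L^p(0, Lᵢ)` with the `ℓ^p` combination of the norms. -/
abbrev X (p : ℝ≥0∞) : Type :=
  PiLp p (fun i : Fin N => Lp ℝ p (volume.restrict (Ioo 0 (S.L i))))

section Space

variable {S} {p : ℝ≥0∞}

/-- The value at `x ∈ [0, Lᵢ]` of the continuous representative of the `i`-th component. -/
def eval (z : S.X p) (i : Fin N) (x : ℝ) : ℝ := contRep (S.L i) (z i) x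

/-- `z ∈ ∏ᵢ W^{1,p}(0, Lᵢ)`. -/
def MemW (z : S.X p) : Prop :=
  ∀ i, ∃ g : Lp ℝ p (volume.restrict (Ioo 0 (S.L i))), HasWeakDeriv (S.L i) (z i) g

/-- `z ∈ D(A)`: Sobolev regularity and the transmission condition `uᵢ(0) = ∑ⱼ mᵢⱼ uⱼ(Lⱼ)`. -/
def MemDomA (z : S.X p) : Prop :=
  MemW z ∧ ∀ i, eval z i 0 = ∑ j, S.M i j * eval z j (S.L j)

/-- The operator `A(u₁, …, u_N) = (-u₁', …, -u_N')` with weak derivatives (only used on `D(A)`). -/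
def opA (z : S.X p) : S.X p := WithLp.toLp p fun i => -weakDeriv (z i)

/-- The operator `Bᵢ(u₁, …, u_N) = (0, …, -χᵢ uᵢ, …, 0)`, `χᵢ` the indicator of `[aᵢ, bᵢ]`. -/
def opB (i : Fin N) (z : S.X p) : S.X p :=
  WithLp.toLp p fun k => if k = i then -mulIndicatorLp (S.a k) (S.b k) (z k) else 0

/-- `z` is a regular solution on `[0, ∞)` of `ż = A z + ∑_{i ≤ Nd} αᵢ(t) Bᵢ z`, `z(0) = z₀`.
The derivative `ż ∈ L^∞_loc` is the derivative of `z` almost everywhere and also in the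
distributional sense, that is, `z` is a primitive of `ż`. -/
structure IsRegularSolution [Fact (1 ≤ p)] (z₀ : S.X p) (z : ℝ → S.X p) : Prop where
  continuousOn : ContinuousOn z (Ici 0)
  initial : z 0 = z₀
  mem_domain : ∀ t, 0 ≤ t → MemDomA (z t)
  differentiable : ∀ᵐ t ∂(volume.restrict (Ici (0 : ℝ))), DifferentiableAt ℝ z t
  deriv_bdd : ∀ R : ℝ, MemLp (deriv z) (⊤ : ℝ≥0∞) (volume.restrict (Icc 0 R))
  primitive : ∀ t, 0 ≤ t → z t = z 0 + ∫ s in (0 : ℝ)..t, deriv z s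
  equation : ∀ᵐ t ∂(volume.restrict (Ici (0 : ℝ))),
    deriv z t = opA (z t) +
      ∑ i ∈ Finset.univ.filter (fun i : Fin N => (i : ℕ) < S.Nd), S.α i t • opB i (z t)

end Space

/-- `L(n) = ∑ᵢ nᵢ Lᵢ`. -/
def len (n : Fin N → ℕ) : ℝ := ∑ i, (n i : ℝ) * S.L i

/-- `ε_{j,n,x,t} = exp(-∫_I αⱼ)` with
`I = [t - L(n) - Lⱼ + max(x, aⱼ), t - L(n) - Lⱼ + bⱼ]` (empty if the endpoints are reversed). -/
def damp (j : Fin N) (n : Fin N → ℕ) (x t : ℝ) : ℝ :=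
  Real.exp (-∫ s in Icc (t - S.len n - S.L j + max x (S.a j)) (t - S.len n - S.L j + S.b j),
    S.α j s)

/-- `ϑ⁽ⁱ⁾_{j,n,Lⱼ,t}`, by recursion on `|n|`: it is `mᵢⱼ` for `n = 0`, and otherwise
`∑_{k, nₖ ≥ 1} mₖⱼ ϑ⁽ⁱ⁾_{k,n-1ₖ,0,t}`, where `ϑ⁽ⁱ⁾_{k,n,0,t} = ε_{k,n,0,t} ϑ⁽ⁱ⁾_{k,n,Lₖ,t}`. -/
def varthetaEnd (i : Fin N) (t : ℝ) (j : Fin N) (n : Fin N → ℕ) : ℝ :=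
  if n = 0 then S.M i j
  else ∑ k, if h : 1 ≤ n k then
    S.M k j * (S.damp k (n - Pi.single k 1) 0 t * varthetaEnd i t k (n - Pi.single k 1))
  else 0
termination_by ∑ k, n k
decreasing_by
  refine Finset.sum_lt_sum (fun l _ => Nat.sub_le _ _) ⟨k, Finset.mem_univ k, ?_⟩
  simp only [Pi.sub_apply, Pi.single_eq_same]
  omega

/-- `ϑ⁽ⁱ⁾_{j,n,x,t} = ε_{j,n,x,t} ϑ⁽ⁱ⁾_{j,n,Lⱼ,t}`. -/
def vartheta (i j : Fin N) (n : Fin N → ℕ) (x t : ℝ) : ℝ :=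
  S.damp j n x t * S.varthetaEnd i t j n

/-- The multi-indices `n` with `nⱼ = 0` and `L(n) ≤ t` are finitely many. -/
theorem finite_indices (j : Fin N) (t : ℝ) : {n : Fin N → ℕ | n j = 0 ∧ S.len n ≤ t}.Finite := by
  refine (Set.finite_Iic (fun i => ⌊t / S.L i⌋₊)).subset ?_
  rintro n ⟨-, hn⟩ i
  refine Nat.le_floor ((le_div_iff₀ (S.L_pos i)).2 (le_trans ?_ hn))
  exact Finset.single_le_sum (f := fun i => (n i : ℝ) * S.L i)
    (fun k _ => mul_nonneg (Nat.cast_nonneg _) (S.L_pos k).le) (Finset.mem_univ i)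

/-- The finite set of the multi-indices `n` with `nⱼ = 0` and `L(n) ≤ t`. -/
def indices (j : Fin N) (t : ℝ) : Finset (Fin N → ℕ) := (S.finite_indices j t).toFinset

/-- `{x}_y = x - ⌊x / y⌋ y`. -/
def fracMod (x y : ℝ) : ℝ := x - (⌊x / y⌋ : ℝ) * y

/-- The damping factor accumulated up to time `t` along the characteristic through `(t, x)`:
`exp(-∫ αᵢ)` over `[0, t] ∩ [t - x + aᵢ, t - x + bᵢ]`. -/
def flowDamp (i : Fin N) (t x : ℝ) : ℝ :=
  Real.exp (-∫ s in Icc 0 t ∩ Icc (t - x + S.a i) (t - x + S.b i), S.α i s)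

end CircleNetwork

end

/-! Fix a component `u` on a circle of length `ℓ`, and a characteristic `x = y + s`. Formally `u(s,
y + s)` solves an ODE with rate `-α(s)` while `s` lies in `[a - y, b - y]`, and this is the
exponential formula. The solution is only Lipschitz in time with values in `L^p`, so the ODE is
proved for averages: for a bump `ψ` of width `δ` around `y`, the pairing `m(s) = ∫ u(s, x) ψ(x - s)
dx` is Lipschitz and, in its derivative, the transport term cancels the motion of `ψ`
(`ae_hasDerivAt_pairing`). What remains is the damping term. Up to a set of times of measure at most
`4δ`, the bump lies entirely inside or entirely outside `[a, b]`, so `m(s)` times the integrating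
factor is constant up to `O(δ)` (`abs_pairing_sub_le`). As `δ → 0` the averages become point values
of the continuous representatives (`contRep_interior`), and continuity in `y` reaches the endpoints
(`contRep_characteristic`).

The formula at `x = 0` comes from iterating the transmission condition backwards in time. The value
`u_j(t - L(n), L_j)` is a damped `u_j(t - L(n) - L_j, 0)`, hence a combination of end values indexed
by `n + 1_j`, as long as `L(n) + L_j ≤ t`; otherwise the characteristic reaches the initial datum.
Damping depends on the past path only through `n`, so paths with the same `n` and the same current
circle merge into one coefficient. Counting all pairs `(j, n)` with `L(n) ≤ t` in two ways leaves
only the terminal ones (`sum_varthetaEnd_mul`), and a floor function parametrizes these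
(`sum_indices_eq`). -/

noncomputable section

/-! ### Weak derivatives on an interval -/

/-- A smooth function with compact support in `(0, ℓ)` is supported in some `[c, d] ⊆ (0, ℓ)`. -/
theorem exists_Icc_tsupport_subset {ℓ : ℝ} (hℓ : 0 < ℓ) {φ : ℝ → ℝ} (hc : HasCompactSupport φ)
    (hs : tsupport φ ⊆ Ioo 0 ℓ) :
    ∃ c d, 0 < c ∧ c < d ∧ d < ℓ ∧ ∀ x, x ∉ Icc c d → φ x = 0 := by
  -- The two added points make the compact set nonempty with distinct least and greatest elements,
  -- even if `φ = 0`.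
  have hK : IsCompact (insert (ℓ / 2) (insert (ℓ / 3) (tsupport φ))) :=
    (hc.isCompact.insert _).insert _
  have hK' : insert (ℓ / 2) (insert (ℓ / 3) (tsupport φ)) ⊆ Ioo 0 ℓ := by
    intro x hx
    rcases hx with rfl | rfl | hx
    · constructor <;> linarith
    · constructor <;> linarith
    · exact hs hx
  obtain ⟨c, hcK, hcl⟩ := hK.exists_isLeast ⟨_, mem_insert _ _⟩
  obtain ⟨d, hdK, hdu⟩ := hK.exists_isGreatest ⟨_, mem_insert _ _⟩
  refine ⟨c, d, (hK' hcK).1, ?_, (hK' hdK).2, fun x hx => ?_⟩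
  · have h1 := hcl (mem_insert_of_mem _ (mem_insert (ℓ / 3) _))
    have h2 := hdu (mem_insert (ℓ / 2) _)
    linarith
  · by_contra h
    have hxK : x ∈ insert (ℓ / 2) (insert (ℓ / 3) (tsupport φ)) :=
      mem_insert_of_mem _ (mem_insert_of_mem _ (subset_tsupport φ h))
    exact hx ⟨hcl hxK, hdu hxK⟩

theorem integral_Ioo_eq_intervalIntegral {ℓ : ℝ} (hℓ : 0 < ℓ) (f : ℝ → ℝ) :
    ∫ x in Ioo 0 ℓ, f x = ∫ x in (0 : ℝ)..ℓ, f x := by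
  rw [intervalIntegral.integral_of_le hℓ.le, integral_Ioc_eq_integral_Ioo]

theorem intervalIntegrable_of_Ioo {ℓ : ℝ} (hℓ : 0 < ℓ) {f : ℝ → ℝ} (hf : IntegrableOn f (Ioo 0 ℓ)) :
    IntervalIntegrable f volume 0 ℓ := by
  rwa [intervalIntegrable_iff_integrableOn_Ioo_of_le hℓ.le]

/-- Integration by parts for absolutely continuous functions; the boundary terms vanish because `φ`
does at `0` and `ℓ`. -/
theorem hasWeakDeriv_primitive {ℓ : ℝ} (hℓ : 0 < ℓ) {g : ℝ → ℝ} (hg : IntegrableOn g (Ioo 0 ℓ)) :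
    HasWeakDeriv ℓ (fun x => ∫ t in (0 : ℝ)..x, g t) g := by
  intro φ hφ hc hs
  have hgi := intervalIntegrable_of_Ioo hℓ hg
  obtain ⟨C, hC⟩ := hφ.lipschitzWith_of_hasCompactSupport hc (by simp)
  have hφac : AbsolutelyContinuousOnInterval φ 0 ℓ := hC.lipschitzOnWith.absolutelyContinuousOnInterval
  have hGac := hgi.absolutelyContinuousOnInterval_intervalIntegral (c := 0) left_mem_uIcc
  have h0 : φ 0 = 0 := image_eq_zero_of_notMem_tsupport fun h => (hs h).1.false
  have h1 : φ ℓ = 0 := image_eq_zero_of_notMem_tsupport fun h => (hs h).2.false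
  rw [integral_Ioo_eq_intervalIntegral hℓ, integral_Ioo_eq_intervalIntegral hℓ,
    hGac.integral_mul_deriv_eq_deriv_mul hφac, h0, h1]
  simp only [mul_zero, sub_zero, zero_sub, neg_inj]
  refine intervalIntegral.integral_congr_ae ?_
  filter_upwards [hgi.ae_hasDerivAt_integral] with x hx hx'
  rw [(hx (uIoc_subset_uIcc hx') 0 left_mem_uIcc).deriv]

theorem integrableOn_mul_of_continuous {ℓ : ℝ} {f φ : ℝ → ℝ} (hf : IntegrableOn f (Ioo 0 ℓ))
    (hφ : Continuous φ) : IntegrableOn (fun x => f x * φ x) (Ioo 0 ℓ) := by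
  have h : IntegrableOn f (Icc 0 ℓ) := by
    rwa [IntegrableOn, ← Measure.restrict_congr_set Ioo_ae_eq_Icc]
  exact (h.mul_continuousOn hφ.continuousOn isCompact_Icc).mono_set Ioo_subset_Icc_self

/-- The **du Bois-Reymond lemma**: a function with vanishing weak derivative is constant. -/
theorem ae_const_of_hasWeakDeriv_zero {ℓ : ℝ} (hℓ : 0 < ℓ) {h : ℝ → ℝ}
    (hh : IntegrableOn h (Ioo 0 ℓ)) (hw : HasWeakDeriv ℓ h 0) :
    ∃ k, ∀ᵐ x ∂(volume.restrict (Ioo 0 ℓ)), h x = k := by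
  let B : ContDiffBump (ℓ / 2) := ⟨ℓ / 8, ℓ / 4, by linarith, by linarith⟩
  set φ₀ := B.normed volume with hφ₀
  have hφ₀s : tsupport φ₀ ⊆ Ioo 0 ℓ := by
    rw [hφ₀, B.tsupport_normed_eq, Real.closedBall_eq_Icc]
    exact fun x hx => ⟨by linarith [hx.1, show B.rOut = ℓ / 4 from rfl],
      by linarith [hx.2, show B.rOut = ℓ / 4 from rfl]⟩
  have hφ₀c : HasCompactSupport φ₀ := B.hasCompactSupport_normed
  have hφ₀d : ContDiff ℝ ∞ φ₀ := B.contDiff_normed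
  have hφ₀i : ∫ x, φ₀ x = 1 := B.integral_normed
  refine ⟨∫ x in Ioo 0 ℓ, h x * φ₀ x, ?_⟩
  set k := ∫ x in Ioo 0 ℓ, h x * φ₀ x with hk
  have key : ∀ φ : ℝ → ℝ, ContDiff ℝ ∞ φ → HasCompactSupport φ → tsupport φ ⊆ Ioo 0 ℓ →
      ∫ x, φ x • (h x - k) = 0 := by
    intro φ hφ hc hs
    set q := ∫ x, φ x with hq
    -- Subtracting this multiple of `φ₀` gives mean zero, so the primitive of `η` is again a
    -- compactly supported test function.
    set η : ℝ → ℝ := fun x => φ x - q * φ₀ x with hη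
    have hηd : ContDiff ℝ ∞ η := hφ.sub (contDiff_const.mul hφ₀d)
    have hηc : HasCompactSupport η := hc.sub (hφ₀c.mul_left (f := fun _ => q))
    have hηs : tsupport η ⊆ Ioo 0 ℓ :=
      (tsupport_sub φ _).trans (union_subset hs
        ((tsupport_mul_subset_right (f := fun _ => q)).trans hφ₀s))
    obtain ⟨c, d, hc0, hcd, hdℓ, hout⟩ := exists_Icc_tsupport_subset hℓ hηc hηs
    have hηi : ∫ x, η x = 0 := by
      rw [hη, integral_sub (hφ.continuous.integrable_of_hasCompactSupport hc)
        ((hφ₀d.continuous.integrable_of_hasCompactSupport hφ₀c).const_mul q),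
        integral_const_mul, hφ₀i, hq]
      ring
    set Φ : ℝ → ℝ := fun x => ∫ t in (0 : ℝ)..x, η t with hΦ
    have hΦd : ∀ x, HasDerivAt Φ (η x) x := fun x =>
      intervalIntegral.integral_hasDerivAt_right (hηd.continuous.intervalIntegrable _ _)
        (hηd.continuous.stronglyMeasurableAtFilter _ _) hηd.continuous.continuousAt
    have hΦ' : deriv Φ = η := funext fun x => (hΦd x).deriv
    have hΦs : ContDiff ℝ ∞ Φ :=
      contDiff_infty_iff_deriv.2 ⟨fun x => (hΦd x).differentiableAt, hΦ' ▸ hηd⟩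
    have hΦout : ∀ x, x ∉ Icc c d → Φ x = 0 := by
      intro x hx
      rcases lt_or_ge x c with hxc | hxc
      · refine intervalIntegral.integral_zero_ae (Filter.Eventually.of_forall fun t ht => hout t ?_)
        intro ht'
        rw [mem_uIoc] at ht
        rcases ht with ht | ht <;> linarith [ht.1, ht.2, ht'.1]
      · have hxd : d < x := by
          by_contra hxd
          exact hx ⟨hxc, not_lt.1 hxd⟩
        rw [hΦ, ← hηi]
        refine intervalIntegral.integral_eq_integral_of_support_subset fun t ht => ?_
        by_contra ht'
        refine ht (hout t fun h => ht' ⟨by linarith [h.1], by linarith [h.2]⟩)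
    have hΦt : tsupport Φ ⊆ Icc c d :=
      closure_minimal (fun x hx => by by_contra h; exact hx (hΦout x h)) isClosed_Icc
    have hΦc : HasCompactSupport Φ := isCompact_Icc.of_isClosed_subset (isClosed_tsupport _) hΦt
    have h1 := hw Φ hΦs hΦc
      (hΦt.trans fun x hx => ⟨by linarith [hx.1], by linarith [hx.2]⟩)
    rw [hΦ'] at h1
    simp only [Pi.zero_apply, zero_mul, integral_zero, neg_zero] at h1
    have i1 := integrableOn_mul_of_continuous hh hφ.continuous
    have i2 := integrableOn_mul_of_continuous hh hφ₀d.continuous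
    have h2 : ∫ x in Ioo 0 ℓ, h x * η x = (∫ x in Ioo 0 ℓ, h x * φ x) - q * k := by
      rw [hk, ← integral_const_mul, ← integral_sub i1 (i2.const_mul q)]
      exact integral_congr_ae (Filter.Eventually.of_forall fun x => by simp only [hη]; ring)
    have h3 : ∫ x in Ioo 0 ℓ, φ x = q :=
      setIntegral_eq_integral_of_forall_compl_eq_zero fun x hx =>
        image_eq_zero_of_notMem_tsupport fun h => hx (hs h)
    have h4 : ∫ x, φ x • (h x - k) = ∫ x in Ioo 0 ℓ, φ x • (h x - k) :=
      (setIntegral_eq_integral_of_forall_compl_eq_zero fun x hx => by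
        rw [image_eq_zero_of_notMem_tsupport fun h => hx (hs h), zero_smul]).symm
    have h5 : ∫ x in Ioo 0 ℓ, φ x • (h x - k) = (∫ x in Ioo 0 ℓ, h x * φ x) - k * q := by
      rw [← h3, ← integral_const_mul, ← integral_sub i1
        ((hφ.continuous.integrable_of_hasCompactSupport hc).integrableOn.const_mul k)]
      exact integral_congr_ae (Filter.Eventually.of_forall fun x => by simp only [smul_eq_mul]; ring)
    rw [h4, h5]
    linarith
  have hli : LocallyIntegrableOn (fun x => h x - k) (Ioo 0 ℓ) :=
    (hh.sub (integrableOn_const (by simp))).locallyIntegrableOn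
  have := isOpen_Ioo.ae_eq_zero_of_integral_contDiff_smul_eq_zero hli key
  rw [ae_restrict_iff' measurableSet_Ioo]
  filter_upwards [this] with x hx hx'
  linarith [hx hx']

/-- The difference of `f` and the primitive of `g` has weak derivative zero, so the du Bois-Reymond
lemma applies. -/
theorem HasWeakDeriv.exists_ae_eq_primitive {ℓ : ℝ} (hℓ : 0 < ℓ) {f g : ℝ → ℝ}
    (hf : IntegrableOn f (Ioo 0 ℓ)) (hg : IntegrableOn g (Ioo 0 ℓ)) (h : HasWeakDeriv ℓ f g) :
    ∃ k, ∀ᵐ x ∂(volume.restrict (Ioo 0 ℓ)), f x = k + ∫ t in (0 : ℝ)..x, g t := by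
  have hG := (intervalIntegrable_of_Ioo hℓ hg).absolutelyContinuousOnInterval_intervalIntegral
    (c := 0) left_mem_uIcc
  have hGc : ContinuousOn (fun x => ∫ t in (0 : ℝ)..x, g t) (Icc 0 ℓ) := by
    simpa [uIcc_of_le hℓ.le] using hG.continuousOn
  have hGi : IntegrableOn (fun x => ∫ t in (0 : ℝ)..x, g t) (Ioo 0 ℓ) :=
    (hGc.integrableOn_Icc).mono_set Ioo_subset_Icc_self
  obtain ⟨k, hk⟩ := ae_const_of_hasWeakDeriv_zero hℓ (hf.sub hGi) (by
    intro φ hφ hc hs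
    have h1 := h φ hφ hc hs
    have h2 := hasWeakDeriv_primitive hℓ hg φ hφ hc hs
    have hd : Continuous (deriv φ) := hφ.continuous_deriv (by simp)
    change ∫ x in Ioo 0 ℓ, (f x - ∫ t in (0 : ℝ)..x, g t) * deriv φ x
      = -∫ x in Ioo 0 ℓ, (0 : ℝ) * φ x
    simp only [sub_mul, zero_mul, integral_zero, neg_zero]
    rw [integral_sub (integrableOn_mul_of_continuous hf hd) (integrableOn_mul_of_continuous hGi hd),
      h1, h2, sub_self])
  refine ⟨k, ?_⟩
  filter_upwards [hk] with x hx
  simp only [Pi.sub_apply] at hx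
  linarith

theorem HasWeakDeriv.exists_continuousOn {ℓ : ℝ} (hℓ : 0 < ℓ) {f g : ℝ → ℝ}
    (hf : IntegrableOn f (Ioo 0 ℓ)) (hg : IntegrableOn g (Ioo 0 ℓ)) (h : HasWeakDeriv ℓ f g) :
    ∃ F : ℝ → ℝ, ContinuousOn F (Icc 0 ℓ) ∧ f =ᵐ[volume.restrict (Ioo 0 ℓ)] F := by
  obtain ⟨k, hk⟩ := h.exists_ae_eq_primitive hℓ hf hg
  have hG := (intervalIntegrable_of_Ioo hℓ hg).absolutelyContinuousOnInterval_intervalIntegral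
    (c := 0) left_mem_uIcc
  refine ⟨_, continuousOn_const.add ?_, hk⟩
  simpa [uIcc_of_le hℓ.le] using hG.continuousOn

/-- The embedding `W^{1,1}(0, ℓ) ⊆ L^∞(0, ℓ)`. -/
theorem HasWeakDeriv.ae_abs_le {ℓ : ℝ} (hℓ : 0 < ℓ) {f g : ℝ → ℝ}
    (hf : IntegrableOn f (Ioo 0 ℓ)) (hg : IntegrableOn g (Ioo 0 ℓ)) (h : HasWeakDeriv ℓ f g) :
    ∀ᵐ x ∂(volume.restrict (Ioo 0 ℓ)),
      |f x| ≤ ℓ⁻¹ * (∫ x in Ioo 0 ℓ, |f x|) + 2 * ∫ x in Ioo 0 ℓ, |g x| := by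
  obtain ⟨k, hk⟩ := h.exists_ae_eq_primitive hℓ hf hg
  have hG : ∀ x ∈ Ioo 0 ℓ, |∫ t in (0 : ℝ)..x, g t| ≤ ∫ x in Ioo 0 ℓ, |g x| := by
    intro x hx
    refine (intervalIntegral.abs_integral_le_integral_abs hx.1.le).trans ?_
    rw [integral_Ioo_eq_intervalIntegral hℓ]
    exact intervalIntegral.integral_mono_interval le_rfl hx.1.le hx.2.le
      (Filter.Eventually.of_forall fun t => abs_nonneg _) (intervalIntegrable_of_Ioo hℓ hg.abs)
  have hm : ∀ᵐ x ∂(volume.restrict (Ioo 0 ℓ)), x ∈ Ioo 0 ℓ := ae_restrict_mem measurableSet_Ioo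
  -- Integrate `|k| ≤ |f x| + ∫ |g|` over the interval.
  have hkb : ℓ * |k| ≤ (∫ x in Ioo 0 ℓ, |f x|) + ℓ * ∫ x in Ioo 0 ℓ, |g x| := by
    have hc : ∀ c : ℝ, ∫ x in Ioo 0 ℓ, c = ℓ * c := fun c => by
      simp [hℓ.le]
    rw [← hc, ← hc, ← integral_add hf.abs (integrableOn_const (by simp))]
    refine integral_mono_ae (integrableOn_const (by simp))
      (hf.abs.add (integrableOn_const (by simp))) ?_
    filter_upwards [hk, hm] with x hx hx'
    have h1 := hG x hx'
    have h2 : k = f x - ∫ t in (0 : ℝ)..x, g t := by linarith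
    have h3 := abs_sub (f x) (∫ t in (0 : ℝ)..x, g t)
    rw [← h2] at h3
    linarith
  have hkb' : |k| ≤ ℓ⁻¹ * (∫ x in Ioo 0 ℓ, |f x|) + ∫ x in Ioo 0 ℓ, |g x| := by
    have := mul_le_mul_of_nonneg_left hkb (inv_nonneg.2 hℓ.le)
    rwa [mul_add, inv_mul_cancel_left₀ hℓ.ne', inv_mul_cancel_left₀ hℓ.ne'] at this
  filter_upwards [hk, hm] with x hx hx'
  have h1 := hG x hx'
  have h3 := abs_add_le k (∫ t in (0 : ℝ)..x, g t)
  rw [← hx] at h3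
  linarith

/-! ### Pairing with moving test functions -/

section Pairing

open scoped BoundedContinuousFunction

variable {ℓ : ℝ} {p : ℝ≥0∞} [Fact (1 ≤ p)]

theorem Lp.integrableOn_Ioo (f : Lp ℝ p (volume.restrict (Ioo 0 ℓ))) : IntegrableOn f (Ioo 0 ℓ) :=
  (Lp.memLp f).integrable Fact.out

/-- Hölder's inequality on a set of finite measure. For `p = ⊤` the convention `⊤.toReal = 0` still
gives the right exponent. -/
theorem Lp.exists_integral_abs_le (ℓ : ℝ) (p : ℝ≥0∞) [Fact (1 ≤ p)] :
    ∃ C, 0 ≤ C ∧ ∀ f : Lp ℝ p (volume.restrict (Ioo 0 ℓ)), ∫ x in Ioo 0 ℓ, |f x| ≤ C * ‖f‖ := by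
  refine ⟨(volume.restrict (Ioo 0 ℓ) univ ^ (1 / (1 : ℝ≥0∞).toReal - 1 / p.toReal)).toReal,
    ENNReal.toReal_nonneg, fun f => ?_⟩
  have hexp : 0 ≤ 1 / (1 : ℝ≥0∞).toReal - 1 / p.toReal := by
    have h1 : (1 : ℝ≥0∞) ≤ p := Fact.out
    rcases eq_or_ne p ⊤ with rfl | hp
    · simp
    · have := (ENNReal.toReal_le_toReal ENNReal.one_ne_top hp).2 h1
      simp only [ENNReal.toReal_one, div_one, one_div] at this ⊢
      linarith [inv_le_one_of_one_le₀ this]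
  have h1 := eLpNorm_le_eLpNorm_mul_rpow_measure_univ (Fact.out : (1 : ℝ≥0∞) ≤ p)
    (Lp.aestronglyMeasurable f)
  have h2 : ∫ x in Ioo 0 ℓ, |f x| = (eLpNorm f 1 (volume.restrict (Ioo 0 ℓ))).toReal := by
    rw [eLpNorm_one_eq_lintegral_enorm,
      ← integral_norm_eq_lintegral_enorm (Lp.aestronglyMeasurable f)]
    rfl
  rw [h2, Lp.norm_def, mul_comm, ← ENNReal.toReal_mul]
  refine ENNReal.toReal_mono (ENNReal.mul_ne_top (Lp.eLpNorm_ne_top f) ?_) h1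
  exact ENNReal.rpow_ne_top_of_nonneg hexp (measure_ne_top _ _)

theorem Lp.integrableOn_mul_bcf (f : Lp ℝ p (volume.restrict (Ioo 0 ℓ))) (φ : ℝ →ᵇ ℝ) :
    IntegrableOn (fun x => f x * φ x) (Ioo 0 ℓ) :=
  integrableOn_mul_of_continuous (Lp.integrableOn_Ioo f) φ.continuous

/-- The pairing `(f, φ) ↦ ∫ f φ` of `L^p(0, ℓ)` with the bounded continuous functions. -/
def pairing (f : Lp ℝ p (volume.restrict (Ioo 0 ℓ))) (φ : ℝ →ᵇ ℝ) : ℝ :=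
  ∫ x in Ioo 0 ℓ, f x * φ x

/-- Provides the product rule when both the solution and the test function depend on time. -/
theorem isBoundedBilinearMap_pairing : IsBoundedBilinearMap ℝ
    (fun q : Lp ℝ p (volume.restrict (Ioo 0 ℓ)) × (ℝ →ᵇ ℝ) => pairing q.1 q.2) where
  add_left f g φ := by
    simp only [pairing]
    rw [← integral_add (Lp.integrableOn_mul_bcf f φ) (Lp.integrableOn_mul_bcf g φ)]
    refine integral_congr_ae ?_
    filter_upwards [Lp.coeFn_add f g] with x hx
    rw [hx, Pi.add_apply, add_mul]
  smul_left c f φ := by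
    simp only [pairing]
    rw [smul_eq_mul, ← integral_const_mul]
    refine integral_congr_ae ?_
    filter_upwards [Lp.coeFn_smul c f] with x hx
    rw [hx, Pi.smul_apply, smul_eq_mul, mul_assoc]
  add_right f φ χ := by
    simp only [pairing]
    rw [← integral_add (Lp.integrableOn_mul_bcf f φ) (Lp.integrableOn_mul_bcf f χ)]
    simp [mul_add]
  smul_right c f φ := by
    simp only [pairing]
    rw [smul_eq_mul, ← integral_const_mul]
    simp [mul_left_comm]
  bound := by
    obtain ⟨C, hC0, hC⟩ := Lp.exists_integral_abs_le ℓ p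
    -- A strictly positive constant is required, and `C` may be zero.
    refine ⟨C + 1, by positivity, fun f φ => ?_⟩
    refine (norm_integral_le_integral_norm _).trans ?_
    refine (integral_mono_of_nonneg (Filter.Eventually.of_forall fun x => norm_nonneg _)
      ((Lp.integrableOn_Ioo f).abs.mul_const ‖φ‖)
      (Filter.Eventually.of_forall fun x => ?_)).trans ?_
    · simp only [norm_mul, Real.norm_eq_abs]
      exact mul_le_mul_of_nonneg_left (φ.norm_coe_le_norm x) (abs_nonneg _)
    · rw [integral_mul_const]
      refine mul_le_mul_of_nonneg_right ((hC f).trans ?_) (norm_nonneg _)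
      nlinarith [norm_nonneg f]

/-- The bounded continuous function given by a continuous function with compact support. -/
def bcfOfHasCompactSupport (ψ : ℝ → ℝ) (hψ : Continuous ψ) (hc : HasCompactSupport ψ) : ℝ →ᵇ ℝ :=
  BoundedContinuousFunction.ofNormedAddCommGroup ψ hψ
    (hc.exists_bound_of_continuous hψ).choose (hc.exists_bound_of_continuous hψ).choose_spec

/-- The translate `x ↦ φ (x - s)`. -/
def translateBCF (φ : ℝ →ᵇ ℝ) (s : ℝ) : ℝ →ᵇ ℝ :=
  φ.compContinuous ⟨fun x => x - s, by fun_prop⟩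

theorem norm_translateBCF_le (φ : ℝ →ᵇ ℝ) (s : ℝ) : ‖translateBCF φ s‖ ≤ ‖φ‖ :=
  (BoundedContinuousFunction.norm_le (norm_nonneg _)).2 fun x => φ.norm_coe_le_norm (x - s)

theorem norm_translateBCF_sub_le {φ : ℝ →ᵇ ℝ} {K : NNReal} (hK : LipschitzWith K φ) (s r : ℝ) :
    ‖translateBCF φ s - translateBCF φ r‖ ≤ K * |s - r| := by
  refine (BoundedContinuousFunction.norm_le (by positivity)).2 fun x => ?_
  have := hK.norm_sub_le (x - s) (x - r)
  rwa [Real.norm_eq_abs (x - s - _), show x - s - (x - r) = -(s - r) by ring, abs_neg] at this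

/-- The derivative is taken in the sup norm: a Lipschitz `φ'` makes the Taylor remainder quadratic
uniformly in `x`. -/
theorem hasDerivAt_translateBCF {φ φ' : ℝ →ᵇ ℝ} (hd : ∀ x, HasDerivAt φ (φ' x) x) {K : NNReal}
    (hK : LipschitzWith K φ') (s : ℝ) :
    HasDerivAt (translateBCF φ) (-translateBCF φ' s) s := by
  rw [hasDerivAt_iff_isLittleO]
  have hb : ∀ r, ‖translateBCF φ r - translateBCF φ s - (r - s) • -translateBCF φ' s‖
      ≤ K * ‖(r - s) ^ 2‖ := by
    intro r
    refine (BoundedContinuousFunction.norm_le (by positivity)).2 fun x => ?_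
    have h := (convex_uIcc (x - s) (x - r)).norm_image_sub_le_of_norm_hasDerivWithin_le
      (f := fun y => φ y - φ' (x - s) * y) (f' := fun y => φ' y - φ' (x - s)) (C := K * |r - s|)
      (fun y _ => by
        have := (hd y).sub ((hasDerivAt_id y).const_mul (φ' (x - s)))
        rw [mul_one] at this
        exact this.hasDerivWithinAt)
      (fun y hy => by
        refine (hK.norm_sub_le y (x - s)).trans (mul_le_mul_of_nonneg_left ?_ K.2)
        have := abs_sub_left_of_mem_uIcc hy
        rw [Real.norm_eq_abs]
        rwa [show x - r - (x - s) = -(r - s) by ring, abs_neg] at this)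
      left_mem_uIcc right_mem_uIcc
    rw [Real.norm_eq_abs (x - r - _), show x - r - (x - s) = -(r - s) by ring, abs_neg] at h
    change |φ (x - r) - φ (x - s) - (r - s) * -φ' (x - s)| ≤ _
    rw [norm_pow, Real.norm_eq_abs (r - s), sq, ← mul_assoc]
    rw [show φ (x - r) - φ (x - s) - (r - s) * -φ' (x - s) = φ (x - r) - φ' (x - s) * (x - r) -
      (φ (x - s) - φ' (x - s) * (x - s)) by ring]
    exact h
  refine (Asymptotics.IsBigO.of_bound K (Filter.Eventually.of_forall hb)).trans_isLittleO ?_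
  simpa using (Asymptotics.isLittleO_pow_sub_sub s one_lt_two).norm_right

end Pairing

/-! ### Damped transport tested against a bump moving at unit speed -/

/-- `u : [0, R] → L^p(0, ℓ)` is Lipschitz and solves `∂ₜu + ∂ₓu + α(t) 1_[a, b] u = 0`, with
`u(s) ∈ W^{1,p}(0, ℓ)`, bounded uniformly in `s`. -/
structure IsDampedTransport {ℓ : ℝ} {p : ℝ≥0∞} [Fact (1 ≤ p)] (a b : ℝ) (α : ℝ → ℝ) (R : ℝ)
    (u : ℝ → Lp ℝ p (volume.restrict (Ioo 0 ℓ))) : Prop where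
  lipschitz : ∃ K, LipschitzOnWith K u (Icc 0 R)
  equation : ∀ᵐ s ∂(volume.restrict (Icc 0 R)),
    ∃ g : Lp ℝ p (volume.restrict (Ioo 0 ℓ)), HasWeakDeriv ℓ (u s) g ∧
      HasDerivAt u (-g - α s • mulIndicatorLp a b (u s)) s
  bounded : ∃ C, ∀ᵐ s ∂(volume.restrict (Icc 0 R)), ∀ᵐ x ∂(volume.restrict (Ioo 0 ℓ)),
    |u s x| ≤ C
  memW : ∀ s ∈ Icc 0 R, ∃ g : Lp ℝ p (volume.restrict (Ioo 0 ℓ)), HasWeakDeriv ℓ (u s) g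

namespace IsDampedTransport

variable {ℓ : ℝ} {p : ℝ≥0∞} [Fact (1 ≤ p)] {a b R : ℝ} {α : ℝ → ℝ}
  {u : ℝ → Lp ℝ p (volume.restrict (Ioo 0 ℓ))}

/-- Needed for absolute continuity, so that the almost everywhere derivative of the pairing can be
integrated back. -/
theorem lipschitzOnWith_pairing (hu : IsDampedTransport a b α R u) {ψ : ℝ → ℝ}
    (hψ : ContDiff ℝ ∞ ψ) (hc : HasCompactSupport ψ) :
    ∃ K, LipschitzOnWith K (fun s => ∫ x in Ioo 0 ℓ, u s x * ψ (x - s)) (Icc 0 R) := by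
  obtain ⟨K, hK⟩ := hu.lipschitz
  obtain ⟨Cu, hCu⟩ := isCompact_Icc.exists_bound_of_continuousOn hK.continuousOn
  set φ := bcfOfHasCompactSupport ψ hψ.continuous hc with hφ
  obtain ⟨Kψ, hKψ⟩ := hψ.lipschitzWith_of_hasCompactSupport hc (by simp)
  have hKφ : LipschitzWith Kψ φ := hKψ
  have hbil := isBoundedBilinearMap_pairing (ℓ := ℓ) (p := p)
  obtain ⟨B, hB0, hB⟩ := hbil.bound
  refine ⟨Real.toNNReal (B * (K * ‖φ‖ + Cu * Kψ)), LipschitzOnWith.of_dist_le' ?_⟩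
  intro s hs r hr
  change dist (pairing (u s) (translateBCF φ s)) (pairing (u r) (translateBCF φ r)) ≤ _
  have e : pairing (u s) (translateBCF φ s) - pairing (u r) (translateBCF φ r)
      = pairing (u s - u r) (translateBCF φ s)
        + pairing (u r) (translateBCF φ s - translateBCF φ r) := by
    have h1 := hbil.map_sub_left (x := u s) (y := u r) (z := translateBCF φ s)
    have h2 := hbil.map_sub_right (x := u r) (y := translateBCF φ s) (z := translateBCF φ r)
    simp only at h1 h2
    rw [h1, h2]
    ring
  have h1 : ‖u s - u r‖ ≤ K * dist s r := by simpa [dist_eq_norm] using hK.dist_le_mul s hs r hr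
  have h2 : ‖translateBCF φ s - translateBCF φ r‖ ≤ Kψ * dist s r :=
    norm_translateBCF_sub_le hKφ s r
  have hCu0 : 0 ≤ Cu := (norm_nonneg _).trans (hCu s hs)
  rw [dist_eq_norm, e]
  calc _ ≤ B * (K * dist s r) * ‖φ‖ + B * Cu * (Kψ * dist s r) := by
        refine (norm_add_le _ _).trans (add_le_add ?_ ?_)
        · refine (hB _ _).trans ?_
          gcongr
          exact norm_translateBCF_le φ s
        · refine (hB _ _).trans ?_
          gcongr
          exact hCu r hr
    _ = _ := by ring

/-- Translating `ψ` contributes `-∫ u ψ'`, and the weak derivative of `u` contributes `+∫ u ψ'`;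
they cancel and only damping is left. The support condition makes the translate of `ψ` an admissible
test function. -/
theorem ae_hasDerivAt_pairing (hu : IsDampedTransport a b α R u) {ψ : ℝ → ℝ}
    (hψ : ContDiff ℝ ∞ ψ) (hc : HasCompactSupport ψ) :
    ∀ᵐ s ∂(volume.restrict (Icc 0 R)), (∀ x ∈ tsupport ψ, x + s ∈ Ioo 0 ℓ) →
      HasDerivAt (fun s => ∫ x in Ioo 0 ℓ, u s x * ψ (x - s))
        (-α s * ∫ x in Ioo 0 ℓ, (Icc a b).indicator (u s) x * ψ (x - s)) s := by
  set φ := bcfOfHasCompactSupport ψ hψ.continuous hc with hφ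
  have hc' : HasCompactSupport (deriv ψ) := hc.deriv
  have hψ' : ContDiff ℝ ∞ (deriv ψ) := (contDiff_infty_iff_deriv.1 hψ).2
  set φ' := bcfOfHasCompactSupport (deriv ψ) hψ'.continuous hc' with hφ'
  obtain ⟨K, hK⟩ := hψ'.lipschitzWith_of_hasCompactSupport hc' (by simp)
  have hKφ' : LipschitzWith K φ' := hK
  have hd : ∀ x, HasDerivAt φ (φ' x) x :=
    fun x => ((contDiff_infty_iff_deriv.1 hψ).1 x).hasDerivAt
  filter_upwards [hu.equation] with s ⟨g, hg, hdu⟩ hsupp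
  have hbil := isBoundedBilinearMap_pairing (ℓ := ℓ) (p := p)
  have h1 := (hbil.hasFDerivAt (u s, translateBCF φ s)).comp_hasDerivAt s
    (hdu.prodMk (hasDerivAt_translateBCF hd hKφ' s))
  have hw := hg (fun x => ψ (x - s)) (hψ.comp (contDiff_id.sub contDiff_const))
    (hc.comp_homeomorph (Homeomorph.subRight s)) (by
      intro x hx
      have : x - s ∈ tsupport ψ := by
        have := tsupport_comp_subset_preimage ψ (f := fun x => x - s) (by fun_prop) hx
        exact this
      simpa using hsupp _ this)
  have hd' : deriv (fun x => ψ (x - s)) = fun x => deriv ψ (x - s) := by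
    funext x
    exact deriv_comp_sub_const ..
  rw [hd'] at hw
  refine h1.congr_deriv ?_
  have e1 := hbil.map_sub_left (x := -g) (y := α s • mulIndicatorLp a b (u s))
    (z := translateBCF φ s)
  have e2 := hbil.smul_left (-1) g (translateBCF φ s)
  have e3 := hbil.smul_left (α s) (mulIndicatorLp a b (u s)) (translateBCF φ s)
  have e4 := hbil.smul_right (-1) (u s) (translateBCF φ' s)
  simp only [neg_smul, one_smul, smul_eq_mul] at e1 e2 e3 e4
  rw [hbil.deriv_apply]
  simp only
  rw [e1, e2, e3, e4]
  change -1 * (∫ x in Ioo 0 ℓ, u s x * deriv ψ (x - s)) + (-1 * (∫ x in Ioo 0 ℓ, g x * ψ (x - s))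
    - α s * (∫ x in Ioo 0 ℓ, mulIndicatorLp a b (u s) x * ψ (x - s))) = _
  rw [hw]
  have : ∫ x in Ioo 0 ℓ, mulIndicatorLp a b (u s) x * ψ (x - s)
      = ∫ x in Ioo 0 ℓ, (Icc a b).indicator (u s) x * ψ (x - s) := by
    refine integral_congr_ae ?_
    filter_upwards [((Lp.memLp (u s)).indicator
      (measurableSet_Icc (a := a) (b := b))).coeFn_toLp] with x hx
    rw [mulIndicatorLp, hx]
  rw [this]
  ring

end IsDampedTransport

/-! ### Exponential formula along characteristics -/

theorem contRep_spec {ℓ : ℝ} {f : ℝ → ℝ}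
    (h : ∃ g : ℝ → ℝ, ContinuousOn g (Icc 0 ℓ) ∧ f =ᵐ[volume.restrict (Ioo 0 ℓ)] g) :
    ContinuousOn (contRep ℓ f) (Icc 0 ℓ) ∧ f =ᵐ[volume.restrict (Ioo 0 ℓ)] contRep ℓ f := by
  rw [contRep, dif_pos h]
  exact h.choose_spec

theorem intervalIntegrable_indicator_of_ae_mem_Icc {α : ℝ → ℝ} (hα : AEMeasurable α volume)
    (hα' : ∀ᵐ s ∂(volume : Measure ℝ), α s ∈ Icc (0 : ℝ) 1) {T : Set ℝ} (hT : MeasurableSet T)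
    (r s : ℝ) : IntervalIntegrable (T.indicator α) volume r s := by
  rw [intervalIntegrable_iff]
  refine Measure.integrableOn_of_bounded (M := 1) (by simp [uIoc])
    (hα.indicator hT).aestronglyMeasurable ?_
  filter_upwards [ae_restrict_of_ae hα'] with x hx
  by_cases hxT : x ∈ T
  · rw [indicator_of_mem hxT, Real.norm_eq_abs, abs_le]
    exact ⟨by linarith [hx.1], hx.2⟩
  · simp [indicator_of_notMem hxT]

/-- A weighted average of `f` near `x₀` is close to `F x₀`. -/
theorem abs_integral_mul_sub_le {ℓ : ℝ} {f F ψ : ℝ → ℝ} {x₀ δ ε : ℝ}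
    (hf : IntegrableOn f (Ioo 0 ℓ)) (hF : f =ᵐ[volume.restrict (Ioo 0 ℓ)] F)
    (hψ : Continuous ψ) (hψ0 : ∀ x, 0 ≤ ψ x) (hψi : Integrable ψ) (hψ1 : ∫ x, ψ x = 1)
    (hs : ∀ x, x ∉ Icc (x₀ - δ) (x₀ + δ) → ψ x = 0) (h0 : 0 < x₀ - δ) (hℓ : x₀ + δ < ℓ)
    (hε : ∀ x ∈ Icc (x₀ - δ) (x₀ + δ), |F x - F x₀| ≤ ε) :
    |(∫ x in Ioo 0 ℓ, f x * ψ x) - F x₀| ≤ ε := by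
  have h1 : ∫ x in Ioo 0 ℓ, ψ x = 1 := by
    rw [← hψ1]
    refine setIntegral_eq_integral_of_forall_compl_eq_zero fun x hx => hs x fun h => hx ?_
    exact ⟨by linarith [h.1], by linarith [h.2]⟩
  have h2 : (∫ x in Ioo 0 ℓ, f x * ψ x) - F x₀ = ∫ x in Ioo 0 ℓ, (f x * ψ x - F x₀ * ψ x) := by
    rw [integral_sub (integrableOn_mul_of_continuous hf hψ) (hψi.integrableOn.const_mul _),
      integral_const_mul, h1, mul_one]
  have h3 : ε = ∫ x in Ioo 0 ℓ, ε * ψ x := by rw [integral_const_mul, h1, mul_one]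
  rw [h2, h3, ← Real.norm_eq_abs]
  refine norm_integral_le_of_norm_le (hψi.integrableOn.const_mul _) ?_
  filter_upwards [hF] with x hx
  rw [hx, ← sub_mul, norm_mul, Real.norm_eq_abs, Real.norm_eq_abs, abs_of_nonneg (hψ0 x)]
  by_cases hxs : x ∈ Icc (x₀ - δ) (x₀ + δ)
  · exact mul_le_mul_of_nonneg_right (hε x hxs) (hψ0 x)
  · simp [hs x hxs]

namespace IsDampedTransport

variable {ℓ : ℝ} {p : ℝ≥0∞} [Fact (1 ≤ p)] {a b R : ℝ} {α : ℝ → ℝ}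
  {u : ℝ → Lp ℝ p (volume.restrict (Ioo 0 ℓ))}

/-- Controls the error of freezing `1_[a, b]` to a constant `c` on the bump: the two differ by at
most `1`, and `ψ` has mass one. -/
theorem abs_integral_commutator_le {f ψ : ℝ → ℝ} {c C s : ℝ} (hc : c = 0 ∨ c = 1)
    (hC : ∀ᵐ x ∂(volume.restrict (Ioo 0 ℓ)), |f x| ≤ C) (hC0 : 0 ≤ C)
    (hψ0 : ∀ x, 0 ≤ ψ x) (hψi : Integrable ψ) (hψ1 : ∫ x, ψ x = 1) :
    |∫ x in Ioo 0 ℓ, (c * f x - (Icc a b).indicator f x) * ψ (x - s)| ≤ C := by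
  have h1 : ∫ x in Ioo 0 ℓ, ψ (x - s) ≤ 1 := by
    rw [← hψ1, ← integral_sub_right_eq_self ψ s]
    exact setIntegral_le_integral (hψi.comp_sub_right s)
      (Filter.Eventually.of_forall fun x => hψ0 _)
  have h2 : ∫ x in Ioo 0 ℓ, C * ψ (x - s) ≤ C := by
    rw [integral_const_mul]
    exact mul_le_of_le_one_right hC0 h1
  rw [← Real.norm_eq_abs]
  refine (norm_integral_le_of_norm_le
    ((hψi.comp_sub_right s).integrableOn.const_mul C) ?_).trans h2
  filter_upwards [hC] with x hx
  rw [norm_mul, Real.norm_eq_abs, Real.norm_eq_abs, abs_of_nonneg (hψ0 _)]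
  refine mul_le_mul_of_nonneg_right ?_ (hψ0 _)
  by_cases hxs : x ∈ Icc a b
  · rw [indicator_of_mem hxs]
    rcases hc with rfl | rfl <;> simp [hx, hC0]
  · rw [indicator_of_notMem hxs]
    rcases hc with rfl | rfl <;> simp [hx, hC0]

/-- With the integrating factor, the derivative of the product is a commutator, which vanishes
unless the moving bump straddles `a` or `b`. Such times have measure at most `4δ`, and there the
derivative is at most `C * exp R`. -/
theorem abs_pairing_sub_le (hu : IsDampedTransport a b α R u) (hα : AEMeasurable α volume)
    (hα' : ∀ᵐ s ∂(volume : Measure ℝ), α s ∈ Icc (0 : ℝ) 1) {C : ℝ} (hC0 : 0 ≤ C)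
    (hC : ∀ᵐ s ∂(volume.restrict (Icc 0 R)), ∀ᵐ x ∂(volume.restrict (Ioo 0 ℓ)), |u s x| ≤ C)
    {ψ : ℝ → ℝ} (hψ : ContDiff ℝ ∞ ψ) (hc : HasCompactSupport ψ) (hψ0 : ∀ x, 0 ≤ ψ x)
    (hψ1 : ∫ x, ψ x = 1) {y δ s₁ s₂ : ℝ} (hδ : 0 ≤ δ)
    (hs : tsupport ψ ⊆ Icc (y - δ) (y + δ)) (h0 : 0 ≤ s₁) (h12 : s₁ ≤ s₂) (h2R : s₂ ≤ R)
    (hy₁ : 0 < y - δ + s₁) (hy₂ : y + δ + s₂ < ℓ) :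
    |(∫ x in Ioo 0 ℓ, u s₂ x * ψ (x - s₂))
          * Real.exp (∫ r in s₁..s₂, (Icc (a - y) (b - y)).indicator α r)
        - ∫ x in Ioo 0 ℓ, u s₁ x * ψ (x - s₁)| ≤ C * Real.exp R * (4 * δ) := by
  set m : ℝ → ℝ := fun s => ∫ x in Ioo 0 ℓ, u s x * ψ (x - s) with hm
  set β : ℝ → ℝ := (Icc (a - y) (b - y)).indicator α with hβ
  set A : ℝ → ℝ := fun s => ∫ r in s₁..s, β r with hA
  have hβi : ∀ r s, IntervalIntegrable β volume r s :=
    intervalIntegrable_indicator_of_ae_mem_Icc hα hα' measurableSet_Icc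
  have hψi : Integrable ψ := hψ.continuous.integrable_of_hasCompactSupport hc
  have hsub : uIcc s₁ s₂ ⊆ Icc 0 R := by
    rw [uIcc_of_le h12]
    exact Icc_subset_Icc h0 h2R
  obtain ⟨K, hK⟩ := hu.lipschitzOnWith_pairing hψ hc
  have hmac : AbsolutelyContinuousOnInterval m s₁ s₂ :=
    (hK.mono hsub).absolutelyContinuousOnInterval
  have hAac : AbsolutelyContinuousOnInterval A s₁ s₂ :=
    (hβi s₁ s₂).absolutelyContinuousOnInterval_intervalIntegral left_mem_uIcc
  obtain ⟨CA, hCA⟩ := hAac.exists_bound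
  have hβ1 : ∀ᵐ s ∂(volume : Measure ℝ), ‖β s‖ ≤ 1 := by
    filter_upwards [hα'] with s hs
    by_cases hT : s ∈ Icc (a - y) (b - y)
    · rw [hβ, indicator_of_mem hT, Real.norm_eq_abs, abs_le]
      exact ⟨by linarith [hs.1], hs.2⟩
    · simp [hβ, indicator_of_notMem hT]
  have hAle : ∀ s ∈ Icc s₁ s₂, A s ≤ R := by
    intro s hs
    have := intervalIntegral.norm_integral_le_of_norm_le_const_ae (a := s₁) (b := s) (C := 1)
      (f := β) (by filter_upwards [hβ1] with x hx _ using hx)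
    rw [one_mul, Real.norm_eq_abs, abs_of_nonneg (sub_nonneg.2 hs.1)] at this
    linarith [le_abs_self (∫ r in s₁..s, β r), hs.2]
  -- `exp` is Lipschitz on the bounded range of `A`, and `A` is Lipschitz because `|β| ≤ 1` almost
  -- everywhere.
  have hEac : AbsolutelyContinuousOnInterval (fun s => Real.exp (A s)) s₁ s₂ := by
    have hexp : LipschitzOnWith (Real.toNNReal (Real.exp CA)) Real.exp (Iic CA) := by
      refine (convex_Iic CA).lipschitzOnWith_of_nnnorm_hasDerivWithin_le
        (f' := Real.exp) (fun x _ => (Real.hasDerivAt_exp x).hasDerivWithinAt) fun x hx => ?_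
      rw [← NNReal.coe_le_coe, coe_nnnorm, Real.coe_toNNReal _ (Real.exp_pos _).le,
        Real.norm_eq_abs, abs_of_pos (Real.exp_pos _)]
      exact Real.exp_le_exp.2 hx
    obtain ⟨KA, hKA⟩ : ∃ KA, LipschitzOnWith KA A (uIcc s₁ s₂) := by
      refine ⟨1, LipschitzOnWith.of_dist_le_mul fun x _ z _ => ?_⟩
      have := intervalIntegral.norm_integral_le_of_norm_le_const_ae (a := z) (b := x) (C := 1)
        (f := β) (by filter_upwards [hβ1] with x hx _ using hx)
      rw [dist_eq_norm, Real.dist_eq, NNReal.coe_one]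
      rwa [← intervalIntegral.integral_interval_sub_left (hβi s₁ x) (hβi s₁ z)] at this
    exact (hexp.comp hKA fun x hx => (le_abs_self _).trans (hCA x hx)).absolutelyContinuousOnInterval
  have hprod := hmac.fun_mul hEac
  have hFTC := hprod.integral_deriv_eq_sub
  have hA1 : A s₁ = 0 := intervalIntegral.integral_same
  simp only [hA1, Real.exp_zero, mul_one] at hFTC
  rw [← hFTC]
  -- The times at which the window `[y + s - δ, y + s + δ]` contains `a` or `b`.
  set T : Set ℝ := Icc (a - y - δ) (a - y + δ) ∪ Icc (b - y - δ) (b - y + δ) with hT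
  have hTm : MeasurableSet T := measurableSet_Icc.union measurableSet_Icc
  have hTv : volume T ≤ ENNReal.ofReal (4 * δ) := by
    refine (measure_union_le _ _).trans ?_
    rw [Real.volume_Icc, Real.volume_Icc, ← ENNReal.ofReal_add (by linarith) (by linarith)]
    exact ENNReal.ofReal_le_ofReal (by linarith)
  have hTr : volume.real T ≤ 4 * δ := ENNReal.toReal_le_of_le_ofReal (by linarith) hTv
  have hTf : volume T ≠ ⊤ := (hTv.trans_lt ENNReal.ofReal_lt_top).ne
  have hCR : 0 ≤ C * Real.exp R := mul_nonneg hC0 (Real.exp_pos _).le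
  have hbd : ∀ᵐ s ∂(volume : Measure ℝ), s ∈ Ioc s₁ s₂ →
      ‖deriv (fun s => m s * Real.exp (A s)) s‖ ≤ T.indicator (fun _ => C * Real.exp R) s := by
    have hder := hu.ae_hasDerivAt_pairing hψ hc
    rw [ae_restrict_iff' measurableSet_Icc] at hder hC
    filter_upwards [hder, hC, (hβi s₁ s₂).ae_hasDerivAt_integral, hα'] with s hd hCs hAd hαs hss
    have hssI : s ∈ Icc s₁ s₂ := Ioc_subset_Icc_self hss
    have hsR : s ∈ Icc 0 R := ⟨h0.trans hssI.1, hssI.2.trans h2R⟩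
    have hAd' : HasDerivAt A (β s) s := hAd (by rwa [uIcc_of_le h12]) s₁ left_mem_uIcc
    have hmd := hd hsR fun x hx => by
      have := hs hx
      exact ⟨by linarith [this.1, hssI.1], by linarith [this.2, hssI.2]⟩
    have hder := (hmd.mul hAd'.exp).deriv
    -- The value of `1_[a, b]` at the centre `y + s` of the moving bump.
    set c : ℝ := (Icc (a - y) (b - y)).indicator (fun _ => 1) s with hcdef
    have hc01 : c = 0 ∨ c = 1 := by
      by_cases h : s ∈ Icc (a - y) (b - y)
      · right; rw [hcdef, indicator_of_mem h]
      · left; rw [hcdef, indicator_of_notMem h]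
    have hβc : β s = α s * c := by
      by_cases h : s ∈ Icc (a - y) (b - y)
      · rw [hβ, hcdef, indicator_of_mem h, indicator_of_mem h, mul_one]
      · rw [hβ, hcdef, indicator_of_notMem h, indicator_of_notMem h, mul_zero]
    have hψs : Continuous fun x => ψ (x - s) := hψ.continuous.comp (by fun_prop)
    have hui := Lp.integrableOn_Ioo (u s)
    have hcomm : ∫ x in Ioo 0 ℓ, (c * u s x - (Icc a b).indicator (u s) x) * ψ (x - s)
        = c * m s - ∫ x in Ioo 0 ℓ, (Icc a b).indicator (u s) x * ψ (x - s) := by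
      rw [hm, ← integral_const_mul, ← integral_sub
        ((integrableOn_mul_of_continuous hui hψs).const_mul c)
        (integrableOn_mul_of_continuous (hui.indicator measurableSet_Icc) hψs)]
      exact integral_congr_ae (Filter.Eventually.of_forall fun x => by ring)
    have hval : deriv (fun s => m s * Real.exp (A s)) s = Real.exp (A s) * (α s *
        ∫ x in Ioo 0 ℓ, (c * u s x - (Icc a b).indicator (u s) x) * ψ (x - s)) := by
      rw [hcomm]
      refine hder.trans ?_
      rw [hβc]
      ring
    rw [hval]
    by_cases hsT : s ∈ T
    · rw [indicator_of_mem hsT, norm_mul, norm_mul, mul_comm C]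
      refine mul_le_mul ?_ ?_ (by positivity) (Real.exp_pos _).le
      · rw [Real.norm_eq_abs, abs_of_pos (Real.exp_pos _)]
        exact Real.exp_le_exp.2 (hAle s hssI)
      · refine (mul_le_of_le_one_left (norm_nonneg _) ?_).trans
          (abs_integral_commutator_le hc01 (hCs hsR) hC0 hψ0 hψi hψ1)
        rw [Real.norm_eq_abs, abs_of_nonneg hαs.1]
        exact hαs.2
    -- Off `T`, each point of the bump lies on the same side of `a` and of `b` as the centre.
    · have : ∀ x, (c * u s x - (Icc a b).indicator (u s) x) * ψ (x - s) = 0 := by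
        intro x
        by_cases hx : x - s ∈ Icc (y - δ) (y + δ)
        · have hiff : x ∈ Icc a b ↔ s ∈ Icc (a - y) (b - y) := by
            simp only [hT, mem_union, mem_Icc, not_or, not_and_or, not_le] at hsT hx ⊢
            grind
          by_cases h : x ∈ Icc a b
          · rw [hcdef, indicator_of_mem h, indicator_of_mem (hiff.1 h)]
            ring
          · rw [hcdef, indicator_of_notMem h, indicator_of_notMem fun h' => h (hiff.2 h')]
            ring
        · rw [image_eq_zero_of_notMem_tsupport fun h => hx (hs h), mul_zero]
      simp only [this, integral_zero, mul_zero, norm_zero]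
      exact indicator_nonneg (fun _ _ => hCR) s
  have hgi : Integrable (T.indicator fun _ => C * Real.exp R) (volume : Measure ℝ) :=
    (integrable_indicator_iff hTm).2 (integrableOn_const hTf)
  have := intervalIntegral.norm_integral_le_of_norm_le h12 hbd hgi.intervalIntegrable
  refine this.trans ?_
  rw [intervalIntegral.integral_of_le h12]
  refine (setIntegral_le_integral hgi
    (Filter.Eventually.of_forall (indicator_nonneg fun _ _ => hCR))).trans ?_
  rw [integral_indicator hTm, setIntegral_const, smul_eq_mul, mul_comm]
  exact mul_le_mul_of_nonneg_left hTr hCR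

theorem contRep_continuousOn (hℓ : 0 < ℓ) (hu : IsDampedTransport a b α R u) {s : ℝ}
    (hs : s ∈ Icc 0 R) : ContinuousOn (contRep ℓ (u s)) (Icc 0 ℓ) ∧
      u s =ᵐ[volume.restrict (Ioo 0 ℓ)] contRep ℓ (u s) := by
  obtain ⟨g, hg⟩ := hu.memW s hs
  exact contRep_spec (hg.exists_continuousOn hℓ (Lp.integrableOn_Ioo _) (Lp.integrableOn_Ioo _))

theorem contRep_interior (hℓ : 0 < ℓ) (hu : IsDampedTransport a b α R u)
    (hα : AEMeasurable α volume)
    (hα' : ∀ᵐ s ∂(volume : Measure ℝ), α s ∈ Icc (0 : ℝ) 1) {y s₁ s₂ : ℝ}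
    (h0 : 0 ≤ s₁) (h12 : s₁ ≤ s₂) (h2R : s₂ ≤ R) (hy₁ : 0 < y + s₁) (hy₂ : y + s₂ < ℓ) :
    contRep ℓ (u s₂) (y + s₂) * Real.exp (∫ r in s₁..s₂, (Icc (a - y) (b - y)).indicator α r)
      = contRep ℓ (u s₁) (y + s₁) := by
  obtain ⟨C, hC⟩ := hu.bounded
  obtain ⟨hF₁, he₁⟩ := hu.contRep_continuousOn hℓ (s := s₁) ⟨h0, h12.trans h2R⟩
  obtain ⟨hF₂, he₂⟩ := hu.contRep_continuousOn hℓ (s := s₂) ⟨h0.trans h12, h2R⟩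
  set F₁ := contRep ℓ (u s₁)
  set F₂ := contRep ℓ (u s₂)
  set E := Real.exp (∫ r in s₁..s₂, (Icc (a - y) (b - y)).indicator α r) with hE
  have hE0 : 0 < E := Real.exp_pos _
  -- The three terms bound the averaging error at `s₂` (multiplied by `E`), the averaging error at
  -- `s₁`, and the drift of the pairing, with `δ < ε`.
  set k : ℝ := E + 1 + 4 * (max C 0 * Real.exp R) with hk
  have hk0 : 0 < k := by positivity
  suffices h : ∀ ε > 0, |F₂ (y + s₂) * E - F₁ (y + s₁)| ≤ ε * k by
    have h' : ∀ ε > 0, |F₂ (y + s₂) * E - F₁ (y + s₁)| ≤ 0 + ε := fun ε hε => by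
      have := h (ε / k) (div_pos hε hk0)
      rwa [div_mul_cancel₀ _ hk0.ne', ← zero_add ε] at this
    have := le_of_forall_pos_le_add h'
    exact sub_eq_zero.1 (abs_eq_zero.1 (le_antisymm this (abs_nonneg _)))
  intro ε hε
  have hc₁ : ContinuousAt F₁ (y + s₁) :=
    hF₁.continuousAt (Icc_mem_nhds hy₁ (by linarith))
  have hc₂ : ContinuousAt F₂ (y + s₂) :=
    hF₂.continuousAt (Icc_mem_nhds (by linarith) hy₂)
  obtain ⟨δ₁, hδ₁, hF₁'⟩ := Metric.continuousAt_iff.1 hc₁ ε hε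
  obtain ⟨δ₂, hδ₂, hF₂'⟩ := Metric.continuousAt_iff.1 hc₂ ε hε
  obtain ⟨δ, hδ0, hδ⟩ : ∃ δ > 0, δ < δ₁ ∧ δ < δ₂ ∧ δ < ε ∧ δ < y + s₁ ∧ δ < ℓ - (y + s₂) := by
    have hpos : 0 < min δ₁ (min δ₂ (min ε (min (y + s₁) (ℓ - (y + s₂))))) := by
      simp only [lt_min_iff]
      exact ⟨hδ₁, hδ₂, hε, hy₁, by linarith⟩
    refine ⟨_, half_pos hpos, ?_⟩
    have := half_lt_self hpos
    simpa only [lt_min_iff] using this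
  obtain ⟨d1, d2, d3, d4, d5⟩ := hδ
  let B : ContDiffBump y := ⟨δ / 2, δ, by linarith, by linarith⟩
  set ψ := B.normed volume with hψdef
  have hψs : tsupport ψ ⊆ Icc (y - δ) (y + δ) := by
    rw [hψdef, B.tsupport_normed_eq, Real.closedBall_eq_Icc]
  have hψc : HasCompactSupport ψ := B.hasCompactSupport_normed
  have hψd : ContDiff ℝ ∞ ψ := B.contDiff_normed
  have hψ1 : ∫ x, ψ x = 1 := B.integral_normed
  have hψ0 : ∀ x, 0 ≤ ψ x := B.nonneg_normed
  have hψi : Integrable ψ := hψd.continuous.integrable_of_hasCompactSupport hψc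
  have main := hu.abs_pairing_sub_le hα hα' (le_max_right C 0)
    (hC.mono fun s hs => hs.mono fun x hx => hx.trans (le_max_left C 0))
    hψd hψc hψ0 hψ1 hδ0.le hψs h0 h12 h2R (by linarith) (by linarith)
  have avg : ∀ (s : ℝ) (F : ℝ → ℝ), u s =ᵐ[volume.restrict (Ioo 0 ℓ)] F → δ < y + s →
      δ < ℓ - (y + s) → (∀ x, dist x (y + s) ≤ δ → dist (F x) (F (y + s)) < ε) →
      |(∫ x in Ioo 0 ℓ, u s x * ψ (x - s)) - F (y + s)| ≤ ε := by
    intro s F hF e1 e2 hFε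
    refine abs_integral_mul_sub_le (δ := δ) (Lp.integrableOn_Ioo _) hF
      (hψd.continuous.comp (by fun_prop)) (fun x => hψ0 _) (hψi.comp_sub_right s)
      ((integral_sub_right_eq_self ψ s).trans hψ1) (fun x hx => ?_) (by linarith) (by linarith)
      fun x hx => (hFε x ?_).le
    · refine image_eq_zero_of_notMem_tsupport fun h => hx ?_
      have := hψs h
      exact ⟨by linarith [this.1], by linarith [this.2]⟩
    · rw [Real.dist_eq, abs_le]
      exact ⟨by linarith [hx.1], by linarith [hx.2]⟩
  have a₁ := avg s₁ F₁ he₁ d4 (by linarith) fun x hx => hF₁' (hx.trans_lt d1)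
  have a₂ := avg s₂ F₂ he₂ (by linarith) d5 fun x hx => hF₂' (hx.trans_lt d2)
  set m₁ := ∫ x in Ioo 0 ℓ, u s₁ x * ψ (x - s₁)
  set m₂ := ∫ x in Ioo 0 ℓ, u s₂ x * ψ (x - s₂)
  have e : F₂ (y + s₂) * E - F₁ (y + s₁)
      = -((m₂ - F₂ (y + s₂)) * E) + (m₂ * E - m₁) + (m₁ - F₁ (y + s₁)) := by ring
  have hCR : 0 ≤ max C 0 * Real.exp R := by positivity
  rw [e]
  calc _ ≤ |m₂ - F₂ (y + s₂)| * E + max C 0 * Real.exp R * (4 * δ) + ε := by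
        refine (abs_add_le _ _).trans (add_le_add ((abs_add_le _ _).trans (add_le_add ?_ main)) a₁)
        rw [abs_neg, abs_mul, abs_of_pos hE0]
    _ ≤ ε * E + max C 0 * Real.exp R * (4 * ε) + ε := by gcongr
    _ = ε * k := by rw [hk]; ring

/-- Dominated convergence: at `y₀` the integrand is continuous in `y` except for `r = a - y₀` or `r
= b - y₀`, a null set. -/
theorem continuous_integral_indicator (hα : AEMeasurable α volume)
    (hα' : ∀ᵐ s ∂(volume : Measure ℝ), α s ∈ Icc (0 : ℝ) 1) (a b s₁ s₂ : ℝ) :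
    Continuous fun y => ∫ r in s₁..s₂, (Icc (a - y) (b - y)).indicator α r := by
  refine continuous_iff_continuousAt.2 fun y₀ => ?_
  refine intervalIntegral.continuousAt_of_dominated_interval (bound := fun _ => 1)
    (Filter.Eventually.of_forall fun y =>
      (hα.indicator measurableSet_Icc).aestronglyMeasurable.restrict)
    (Filter.Eventually.of_forall fun y => ?_) intervalIntegrable_const ?_
  · filter_upwards [hα'] with r hr _
    by_cases h : r ∈ Icc (a - y) (b - y)
    · rw [indicator_of_mem h, Real.norm_eq_abs, abs_le]
      exact ⟨by linarith [hr.1], hr.2⟩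
    · simp [indicator_of_notMem h]
  · have h1 : ∀ᵐ r ∂(volume : Measure ℝ), r ≠ a - y₀ := by simp [ae_iff]
    have h2 : ∀ᵐ r ∂(volume : Measure ℝ), r ≠ b - y₀ := by simp [ae_iff]
    filter_upwards [h1, h2] with r hr1 hr2 _
    have hcont : ∀ c : ℝ, ContinuousAt (fun y : ℝ => c - y) y₀ := fun c => by fun_prop
    by_cases h : r ∈ Icc (a - y₀) (b - y₀)
    · have e1 := (hcont a).eventually_lt_const (lt_of_le_of_ne h.1 hr1.symm)
      have e2 := (hcont b).eventually_const_lt (lt_of_le_of_ne h.2 hr2)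
      refine (continuousAt_const (y := α r)).congr ?_
      filter_upwards [e1, e2] with y hy1 hy2
      rw [indicator_of_mem (show r ∈ Icc (a - y) (b - y) from ⟨hy1.le, hy2.le⟩)]
    · refine (continuousAt_const (y := (0 : ℝ))).congr ?_
      have : r < a - y₀ ∨ b - y₀ < r := by
        by_contra hcon
        push Not at hcon
        exact h hcon
      rcases this with h' | h'
      · filter_upwards [(hcont a).eventually_const_lt h'] with y hy
        rw [indicator_of_notMem fun hm : r ∈ Icc _ _ => (hy.trans_le hm.1).false]
      · filter_upwards [(hcont b).eventually_lt_const h'] with y hy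
        rw [indicator_of_notMem fun hm : r ∈ Icc _ _ => (hy.trans_le hm.2).false]

/-- Both sides are continuous in `y` on `[-s₁, ℓ - s₂]` and agree in the interior, which is dense
because `s₂ - s₁ < ℓ`. -/
theorem contRep_of_lt (hℓ : 0 < ℓ) (hu : IsDampedTransport a b α R u)
    (hα : AEMeasurable α volume)
    (hα' : ∀ᵐ s ∂(volume : Measure ℝ), α s ∈ Icc (0 : ℝ) 1) {y s₁ s₂ : ℝ}
    (h0 : 0 ≤ s₁) (h12 : s₁ ≤ s₂) (h2R : s₂ ≤ R) (hlt : s₂ - s₁ < ℓ)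
    (hy₁ : 0 ≤ y + s₁) (hy₂ : y + s₂ ≤ ℓ) :
    contRep ℓ (u s₂) (y + s₂) * Real.exp (∫ r in s₁..s₂, (Icc (a - y) (b - y)).indicator α r)
      = contRep ℓ (u s₁) (y + s₁) := by
  obtain ⟨hF₁, -⟩ := hu.contRep_continuousOn hℓ (s := s₁) ⟨h0, h12.trans h2R⟩
  obtain ⟨hF₂, -⟩ := hu.contRep_continuousOn hℓ (s := s₂) ⟨h0.trans h12, h2R⟩
  have hne : -s₁ ≠ ℓ - s₂ := by linarith
  have heq : EqOn (fun y => contRep ℓ (u s₂) (y + s₂)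
      * Real.exp (∫ r in s₁..s₂, (Icc (a - y) (b - y)).indicator α r))
      (fun y => contRep ℓ (u s₁) (y + s₁)) (Ioo (-s₁) (ℓ - s₂)) := fun y hy =>
    hu.contRep_interior hℓ hα hα' h0 h12 h2R (by linarith [hy.1]) (by linarith [hy.2])
  refine heq.of_subset_closure (t := Icc (-s₁) (ℓ - s₂)) ?_ ?_ Ioo_subset_Icc_self
    (closure_Ioo hne).ge ⟨by linarith, by linarith⟩
  · refine (hF₂.comp (by fun_prop) fun y hy => ?_).mul
      (Real.continuous_exp.comp (continuous_integral_indicator hα hα' a b s₁ s₂)).continuousOn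
    exact ⟨by linarith [hy.1], by linarith [hy.2]⟩
  · exact hF₁.comp (by fun_prop) fun y hy => ⟨by linarith [hy.1], by linarith [hy.2]⟩

/-- The solution along a characteristic of `[0, R] × [0, ℓ]`, endpoints included. -/
theorem contRep_characteristic (hℓ : 0 < ℓ) (hu : IsDampedTransport a b α R u)
    (hα : AEMeasurable α volume)
    (hα' : ∀ᵐ s ∂(volume : Measure ℝ), α s ∈ Icc (0 : ℝ) 1) {y s₁ s₂ : ℝ}
    (h0 : 0 ≤ s₁) (h12 : s₁ ≤ s₂) (h2R : s₂ ≤ R) (hy₁ : 0 ≤ y + s₁) (hy₂ : y + s₂ ≤ ℓ) :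
    contRep ℓ (u s₂) (y + s₂)
      = contRep ℓ (u s₁) (y + s₁)
        * Real.exp (-∫ r in Icc s₁ s₂ ∩ Icc (a - y) (b - y), α r) := by
  have hint : ∫ r in s₁..s₂, (Icc (a - y) (b - y)).indicator α r
      = ∫ r in Icc s₁ s₂ ∩ Icc (a - y) (b - y), α r := by
    rw [intervalIntegral.integral_of_le h12, ← integral_Icc_eq_integral_Ioc,
      setIntegral_indicator measurableSet_Icc]
  have key : contRep ℓ (u s₂) (y + s₂)
      * Real.exp (∫ r in s₁..s₂, (Icc (a - y) (b - y)).indicator α r)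
      = contRep ℓ (u s₁) (y + s₁) := by
    rcases lt_or_ge (s₂ - s₁) ℓ with hlt | hge
    · exact hu.contRep_of_lt hℓ hα hα' h0 h12 h2R hlt hy₁ hy₂
    -- Here `s₂ - s₁ = ℓ`: the characteristic crosses the whole interval and `-s₁` is the only
    -- admissible `y`, so there is nothing to take limits over. Each half is short enough.
    · set s := (s₁ + s₂) / 2 with hs
      have k1 := hu.contRep_of_lt hℓ hα hα' (y := y) (s₁ := s₁) (s₂ := s) h0
        (by linarith) (by linarith) (by linarith) hy₁ (by linarith)
      have k2 := hu.contRep_of_lt hℓ hα hα' (y := y) (s₁ := s) (s₂ := s₂) (by linarith)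
        (by linarith) h2R (by linarith) (by linarith) hy₂
      have hi := intervalIntegrable_indicator_of_ae_mem_Icc hα hα'
        (measurableSet_Icc (a := a - y) (b := b - y))
      rw [← intervalIntegral.integral_add_adjacent_intervals (hi s₁ s) (hi s s₂),
        Real.exp_add, ← k1, ← k2]
      ring
  rw [← hint, ← key, mul_assoc, ← Real.exp_add, add_neg_cancel, Real.exp_zero, mul_one]

end IsDampedTransport

/-! ### From regular solutions to scalar transport equations -/

theorem hasWeakDeriv_weakDeriv {p : ℝ≥0∞} {ℓ : ℝ} {f : Lp ℝ p (volume.restrict (Ioo 0 ℓ))}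
    (h : ∃ g : Lp ℝ p (volume.restrict (Ioo 0 ℓ)), HasWeakDeriv ℓ f g) :
    HasWeakDeriv ℓ f (weakDeriv f) := by
  rw [weakDeriv, dif_pos h]
  exact h.choose_spec

theorem mulIndicatorLp_coeFn {p : ℝ≥0∞} {ℓ : ℝ} (a b : ℝ)
    (f : Lp ℝ p (volume.restrict (Ioo 0 ℓ))) :
    mulIndicatorLp a b f =ᵐ[volume.restrict (Ioo 0 ℓ)] (Icc a b).indicator f :=
  ((Lp.memLp f).indicator (measurableSet_Icc (a := a) (b := b))).coeFn_toLp

theorem norm_mulIndicatorLp_le {p : ℝ≥0∞} {ℓ : ℝ} (a b : ℝ)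
    (f : Lp ℝ p (volume.restrict (Ioo 0 ℓ))) : ‖mulIndicatorLp a b f‖ ≤ ‖f‖ := by
  refine Lp.norm_le_norm_of_ae_le ?_
  filter_upwards [mulIndicatorLp_coeFn a b f] with x hx
  rw [hx]
  exact norm_indicator_le_norm_self _ _

theorem mulIndicatorLp_endpoint {p : ℝ≥0∞} {ℓ : ℝ} (f : Lp ℝ p (volume.restrict (Ioo 0 ℓ))) :
    mulIndicatorLp ℓ ℓ f = 0 := by
  refine Lp.ext ?_
  filter_upwards [mulIndicatorLp_coeFn ℓ ℓ f, Lp.coeFn_zero ℝ p (volume.restrict (Ioo 0 ℓ)),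
    ae_restrict_mem measurableSet_Ioo] with x hx h0 hm
  rw [hx, h0, indicator_of_notMem fun h : x ∈ Icc ℓ ℓ => (hm.2.trans_le h.1).false, Pi.zero_apply]

namespace CircleNetwork

variable {N : ℕ} {S : CircleNetwork N} {p : ℝ≥0∞}

theorem a_nonneg_all (S : CircleNetwork N) (i : Fin N) : 0 ≤ S.a i := by
  rcases lt_or_ge (i : ℕ) S.Nd with h | h
  · exact S.a_nonneg i h
  · rw [S.a_undamped i h]
    exact (S.L_pos i).le

theorem b_le_all (S : CircleNetwork N) (i : Fin N) : S.b i ≤ S.L i := by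
  rcases lt_or_ge (i : ℕ) S.Nd with h | h
  · exact S.b_le i h
  · exact (S.b_undamped i h).le

/-- On an undamped circle `[a, b] = {L}` misses `(0, L)`, so the formula gives zero there and all
circles obey the same equation. -/
theorem sum_opB_apply (t : ℝ) (z : S.X p) (i : Fin N) :
    (∑ k ∈ Finset.univ.filter (fun k : Fin N => (k : ℕ) < S.Nd), S.α k t • opB k z) i
      = -(S.α i t • mulIndicatorLp (S.a i) (S.b i) (z i)) := by
  rw [WithLp.ofLp_sum, Finset.sum_apply]
  have h : ∀ k : Fin N, (S.α k t • opB k z : S.X p) i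
      = if i = k then -(S.α i t • mulIndicatorLp (S.a i) (S.b i) (z i)) else 0 := by
    intro k
    have hB : (opB k z : S.X p) i
        = if i = k then -mulIndicatorLp (S.a i) (S.b i) (z i) else 0 := rfl
    have hs : (S.α k t • opB k z : S.X p) i = S.α k t • (opB k z : S.X p) i := rfl
    rw [hs, hB]
    by_cases hk : i = k
    · rw [if_pos hk, if_pos hk, ← hk, smul_neg]
    · rw [if_neg hk, if_neg hk, smul_zero]
  rw [Finset.sum_congr rfl fun k _ => h k, Finset.sum_ite_eq]
  rcases lt_or_ge (i : ℕ) S.Nd with hi | hi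
  · rw [if_pos (by simpa using hi)]
  · rw [if_neg (by simpa using hi), S.a_undamped i hi, S.b_undamped i hi, mulIndicatorLp_endpoint,
      smul_zero, neg_zero]

variable [Fact (1 ≤ p)]

theorem IsRegularSolution.exists_deriv_bound {z₀ : S.X p} {z : ℝ → S.X p}
    (hz : IsRegularSolution z₀ z) (R : ℝ) :
    ∃ K, 0 ≤ K ∧ ∀ᵐ s ∂(volume.restrict (Icc 0 R)), ‖deriv z s‖ ≤ K := by
  have h := (hz.deriv_bdd R).2
  rw [eLpNorm_exponent_top] at h
  refine ⟨(eLpNormEssSup (deriv z) (volume.restrict (Icc 0 R))).toReal,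
    ENNReal.toReal_nonneg, ?_⟩
  filter_upwards [ae_le_eLpNormEssSup (f := deriv z) (μ := volume.restrict (Icc 0 R))] with s hs
  rw [← toReal_enorm]
  exact ENNReal.toReal_mono h.ne hs

theorem IsRegularSolution.exists_lipschitzOnWith {z₀ : S.X p} {z : ℝ → S.X p}
    (hz : IsRegularSolution z₀ z) (R : ℝ) : ∃ K, LipschitzOnWith K z (Icc 0 R) := by
  obtain ⟨K, hK0, hK⟩ := hz.exists_deriv_bound R
  have hint : ∀ t ∈ Icc 0 R, IntervalIntegrable (deriv z) volume 0 t := by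
    intro t ht
    rw [intervalIntegrable_iff_integrableOn_Icc_of_le ht.1]
    have : IntegrableOn (deriv z) (Icc 0 R) := (hz.deriv_bdd R).integrable le_top
    exact this.mono_set (Icc_subset_Icc_right ht.2)
  refine ⟨K.toNNReal, LipschitzOnWith.of_dist_le' fun s hs t ht => ?_⟩
  rw [dist_eq_norm, hz.primitive s hs.1, hz.primitive t ht.1, add_sub_add_left_eq_sub,
    intervalIntegral.integral_interval_sub_left (hint s hs) (hint t ht), Real.dist_eq]
  refine intervalIntegral.norm_integral_le_of_norm_le_const_ae ?_
  rw [ae_restrict_iff' measurableSet_Icc] at hK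
  filter_upwards [hK] with x hx hxs
  refine hx ?_
  rcases mem_uIoc.1 hxs with h | h
  · exact ⟨ht.1.trans h.1.le, h.2.trans hs.2⟩
  · exact ⟨hs.1.trans h.1.le, h.2.trans ht.2⟩

/-- The components of a regular solution solve damped transport equations. -/
theorem IsRegularSolution.isDampedTransport {z₀ : S.X p} {z : ℝ → S.X p}
    (hz : IsRegularSolution z₀ z) (i : Fin N) (R : ℝ) :
    IsDampedTransport (S.a i) (S.b i) (S.α i) R (fun s => z s i) := by
  obtain ⟨K, hK0, hK⟩ := hz.exists_deriv_bound R
  obtain ⟨KL, hKL⟩ := hz.exists_lipschitzOnWith R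
  have hsub : Icc 0 R ⊆ Ici (0 : ℝ) := fun x hx => hx.1
  have heq : ∀ᵐ s ∂(volume.restrict (Icc 0 R)), HasDerivAt z (deriv z s) s ∧
      deriv z s i = -weakDeriv (z s i) - S.α i s • mulIndicatorLp (S.a i) (S.b i) (z s i) := by
    filter_upwards [ae_restrict_of_ae_restrict_of_subset hsub hz.differentiable,
      ae_restrict_of_ae_restrict_of_subset hsub hz.equation] with s hd he
    refine ⟨hd.hasDerivAt, ?_⟩
    rw [he, PiLp.add_apply, sum_opB_apply, sub_eq_add_neg]
    rfl
  have hmem : ∀ s ∈ Icc 0 R, ∃ g : Lp ℝ p (volume.restrict (Ioo 0 (S.L i))),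
      HasWeakDeriv (S.L i) (z s i) g := fun s hs => (hz.mem_domain s hs.1).1 i
  refine ⟨⟨KL, ?_⟩, ?_, ?_, hmem⟩
  · intro s hs t ht
    exact (PiLp.edist_apply_le (z s) (z t) i).trans (hKL hs ht)
  · filter_upwards [heq, ae_restrict_mem measurableSet_Icc] with s ⟨hd, he⟩ hs
    refine ⟨weakDeriv (z s i), hasWeakDeriv_weakDeriv (hmem s hs), ?_⟩
    rw [← he]
    exact (PiLp.proj (𝕜 := ℝ) p _ i).hasFDerivAt.comp_hasDerivAt s hd
  · obtain ⟨B, hB⟩ := isCompact_Icc.exists_bound_of_continuousOn hKL.continuousOn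
    obtain ⟨C, hC0, hC⟩ := Lp.exists_integral_abs_le (S.L i) p
    refine ⟨(S.L i)⁻¹ * (C * B) + 2 * (C * (K + B)), ?_⟩
    filter_upwards [heq, ae_restrict_mem measurableSet_Icc, hK,
      ae_restrict_of_ae (S.α_mem i)] with s ⟨hd, he⟩ hs hKs hαs
    have hub : ‖z s i‖ ≤ B := (PiLp.norm_apply_le (z s) i).trans (hB s hs)
    -- The equation itself bounds the weak derivative by `ż` and `z`; the Sobolev embedding then
    -- gives the uniform bound.
    have hwb : ‖weakDeriv (z s i)‖ ≤ K + B := by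
      have e : weakDeriv (z s i)
          = -(deriv z s i) - S.α i s • mulIndicatorLp (S.a i) (S.b i) (z s i) := by
        rw [he]
        abel
      rw [e]
      refine (norm_sub_le _ _).trans (add_le_add ?_ ?_)
      · rw [norm_neg]
        exact (PiLp.norm_apply_le (deriv z s) i).trans hKs
      · rw [norm_smul, Real.norm_eq_abs, abs_of_nonneg hαs.1]
        exact (mul_le_of_le_one_left (norm_nonneg _) hαs.2).trans
          ((norm_mulIndicatorLp_le _ _ _).trans hub)
    have hL := S.L_pos i
    filter_upwards [(hasWeakDeriv_weakDeriv (hmem s hs)).ae_abs_le hL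
      (Lp.integrableOn_Ioo _) (Lp.integrableOn_Ioo _)] with x hx
    refine hx.trans ?_
    gcongr
    · exact (hC _).trans (by gcongr)
    · exact (hC _).trans (by gcongr)

theorem IsRegularSolution.eval_characteristic {z₀ : S.X p} {z : ℝ → S.X p}
    (hz : IsRegularSolution z₀ z) (i : Fin N) {y s₁ s₂ : ℝ}
    (h0 : 0 ≤ s₁) (h12 : s₁ ≤ s₂) (hy₁ : 0 ≤ y + s₁) (hy₂ : y + s₂ ≤ S.L i) :
    eval (z s₂) i (y + s₂) = eval (z s₁) i (y + s₁)
      * Real.exp (-∫ r in Icc s₁ s₂ ∩ Icc (S.a i - y) (S.b i - y), S.α i r) :=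
  (hz.isDampedTransport i s₂).contRep_characteristic (S.L_pos i) (S.α_meas i) (S.α_mem i)
    h0 h12 le_rfl hy₁ hy₂

theorem IsRegularSolution.eval_of_le {z₀ : S.X p} {z : ℝ → S.X p}
    (hz : IsRegularSolution z₀ z) (i : Fin N) {t x : ℝ} (ht : 0 ≤ t) (htx : t ≤ x)
    (hx : x ≤ S.L i) : eval (z t) i x = eval z₀ i (x - t) * S.flowDamp i t x := by
  have := hz.eval_characteristic i (y := x - t) le_rfl ht (by linarith) (by linarith)
  rw [hz.initial, add_zero, sub_add_cancel] at this
  rw [this, flowDamp, show S.a i - (x - t) = t - x + S.a i by ring,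
    show S.b i - (x - t) = t - x + S.b i by ring]

theorem IsRegularSolution.eval_of_ge {z₀ : S.X p} {z : ℝ → S.X p}
    (hz : IsRegularSolution z₀ z) (i : Fin N) {t x : ℝ} (hx0 : 0 ≤ x) (hxt : x ≤ t)
    (hx : x ≤ S.L i) : eval (z t) i x = eval (z (t - x)) i 0 * S.flowDamp i t x := by
  have := hz.eval_characteristic i (y := x - t) (s₁ := t - x) (s₂ := t) (by linarith)
    (by linarith) (by linarith) (by linarith)
  rw [sub_add_sub_cancel, sub_self, sub_add_cancel] at this
  -- Since `a ≥ 0`, the second interval already forces `r ≥ t - x`, and `t - x ≥ 0`.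
  have hset : Icc (t - x) t ∩ Icc (S.a i - (x - t)) (S.b i - (x - t))
      = Icc 0 t ∩ Icc (t - x + S.a i) (t - x + S.b i) := by
    have ha := S.a_nonneg_all i
    ext r
    simp only [mem_inter_iff, mem_Icc]
    constructor
    · rintro ⟨⟨h1, h2⟩, h3, h4⟩
      exact ⟨⟨by linarith, h2⟩, by linarith, by linarith⟩
    · rintro ⟨⟨h1, h2⟩, h3, h4⟩
      exact ⟨⟨by linarith, h2⟩, by linarith, by linarith⟩
  rw [this, flowDamp, hset]

end CircleNetwork

/-! ### Sums over paths in the network -/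

namespace CircleNetwork

variable {N : ℕ} (S : CircleNetwork N)

theorem len_zero : S.len 0 = 0 := by simp [len]

theorem len_add (m n : Fin N → ℕ) : S.len (m + n) = S.len m + S.len n := by
  simp [len, add_mul, Finset.sum_add_distrib]

theorem len_single (j : Fin N) (k : ℕ) : S.len (Pi.single j k) = k * S.L j := by
  rw [len, Finset.sum_eq_single j]
  · simp
  · intro i _ hi
    simp [hi]
  · simp

theorem finite_len_le (t : ℝ) : {n : Fin N → ℕ | S.len n ≤ t}.Finite := by
  refine (Set.finite_Iic (fun i => ⌊t / S.L i⌋₊)).subset fun n hn i => ?_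
  refine Nat.le_floor ((le_div_iff₀ (S.L_pos i)).2 (le_trans ?_ hn))
  exact Finset.single_le_sum (f := fun i => (n i : ℝ) * S.L i)
    (fun k _ => mul_nonneg (Nat.cast_nonneg _) (S.L_pos k).le) (Finset.mem_univ i)

/-- The finite set of the multi-indices `n` with `L(n) ≤ t`. -/
def lenLE (t : ℝ) : Finset (Fin N → ℕ) := (S.finite_len_le t).toFinset

variable {S}

theorem mem_lenLE {t : ℝ} {n : Fin N → ℕ} : n ∈ S.lenLE t ↔ S.len n ≤ t := by
  simp [lenLE]

theorem mem_indices {j : Fin N} {t : ℝ} {n : Fin N → ℕ} :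
    n ∈ S.indices j t ↔ n j = 0 ∧ S.len n ≤ t := by
  simp [indices]

theorem single_add_sub_single {n : Fin N → ℕ} {j : Fin N} (h : 1 ≤ n j) :
    n - Pi.single j 1 + Pi.single j 1 = n := by
  funext k
  rcases eq_or_ne k j with rfl | hk
  · simp [h]
  · simp [hk]

theorem varthetaEnd_zero (i : Fin N) (t : ℝ) (j : Fin N) : S.varthetaEnd i t j 0 = S.M i j := by
  rw [varthetaEnd, if_pos rfl]

theorem varthetaEnd_of_ne_zero (i : Fin N) (t : ℝ) (j : Fin N) {n : Fin N → ℕ} (hn : n ≠ 0) :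
    S.varthetaEnd i t j n = ∑ k, if 1 ≤ n k then
      S.M k j * (S.damp k (n - Pi.single k 1) 0 t * S.varthetaEnd i t k (n - Pi.single k 1))
      else 0 := by
  rw [varthetaEnd, if_neg hn]
  simp only [dite_eq_ite]

/-- Expansion of a sum over the paths of the network: if `e` satisfies the transport relation
along the circles, the contributions of the paths that cannot be continued add up to the
value at the origin. -/
theorem sum_varthetaEnd_mul (i : Fin N) {t : ℝ} (ht : 0 ≤ t) (e : (Fin N → ℕ) → Fin N → ℝ)
    (he : ∀ j n, S.len n + S.L j ≤ t →
      e n j = S.damp j n 0 t * ∑ k, S.M j k * e (n + Pi.single j 1) k) :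
    ∑ j, ∑ n ∈ S.lenLE t with t < S.len n + S.L j, S.varthetaEnd i t j n * e n j
      = ∑ j, S.M i j * e 0 j := by
  set F : Fin N → (Fin N → ℕ) → ℝ := fun j n => S.varthetaEnd i t j n * e n j with hF
  set w : Fin N → (Fin N → ℕ) → ℝ := fun j n => S.damp j n 0 t * S.varthetaEnd i t j n with hw
  -- The total of `F` is split by `n = 0` or not, and by terminal or not. The recursion and the
  -- shift `n ↦ n - 1_j` identify the second parts, hence the first parts agree.
  have hne : ∑ k, ∑ n ∈ S.lenLE t with ¬n = 0, F k n
      = ∑ j, ∑ n ∈ S.lenLE t with ¬t < S.len n + S.L j, F j n := by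
    calc _ = ∑ k, ∑ n ∈ S.lenLE t with ¬n = 0, ∑ j, if 1 ≤ n j then
          w j (n - Pi.single j 1) * (S.M j k * e n k) else 0 := by
          refine Finset.sum_congr rfl fun k _ => Finset.sum_congr rfl fun n hn => ?_
          simp only [hF]
          rw [varthetaEnd_of_ne_zero i t k (Finset.mem_filter.1 hn).2, Finset.sum_mul]
          refine Finset.sum_congr rfl fun j _ => ?_
          split_ifs
          · simp only [hw]
            ring
          · rw [zero_mul]
      _ = ∑ j, ∑ n ∈ S.lenLE t with ¬n = 0, if 1 ≤ n j then
          w j (n - Pi.single j 1) * ∑ k, S.M j k * e n k else 0 := by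
          rw [Finset.sum_congr rfl fun k _ => Finset.sum_comm, Finset.sum_comm]
          refine Finset.sum_congr rfl fun j _ => ?_
          rw [Finset.sum_comm]
          refine Finset.sum_congr rfl fun n _ => ?_
          split_ifs
          · rw [Finset.mul_sum]
          · simp
      _ = _ := by
          refine Finset.sum_congr rfl fun j _ => ?_
          rw [← Finset.sum_filter]
          refine Finset.sum_bij' (fun n _ => n - Pi.single j 1) (fun n _ => n + Pi.single j 1)
            ?_ ?_ ?_ ?_ ?_
          · intro n hn
            simp only [Finset.mem_filter, mem_lenLE, not_lt] at hn ⊢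
            have h := S.len_add (n - Pi.single j 1) (Pi.single j 1)
            rw [single_add_sub_single hn.2, len_single, Nat.cast_one, one_mul] at h
            have := S.L_pos j
            constructor <;> linarith [hn.1.1]
          · intro n hn
            simp only [Finset.mem_filter, mem_lenLE, not_lt] at hn ⊢
            rw [len_add, len_single, Nat.cast_one, one_mul]
            refine ⟨⟨hn.2, fun h => ?_⟩, by simp⟩
            have := congrFun h j
            simp at this
          · intro n hn
            exact single_add_sub_single (Finset.mem_filter.1 hn).2
          · intro n hn
            funext k
            simp
          · intro n hn
            simp only [Finset.mem_filter, mem_lenLE] at hn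
            have h := S.len_add (n - Pi.single j 1) (Pi.single j 1)
            rw [single_add_sub_single hn.2, len_single, Nat.cast_one, one_mul] at h
            simp only [hF, hw]
            rw [he j (n - Pi.single j 1) (by linarith [hn.1.1]), single_add_sub_single hn.2]
            ring
  have h0 : ∑ k, ∑ n ∈ S.lenLE t with n = 0, F k n = ∑ j, S.M i j * e 0 j := by
    refine Finset.sum_congr rfl fun k _ => ?_
    have : (S.lenLE t).filter (fun n => n = 0) = {0} := by
      ext n
      simp only [Finset.mem_filter, mem_lenLE, Finset.mem_singleton]
      exact ⟨fun h => h.2, fun h => ⟨by rw [h, len_zero]; exact ht, h⟩⟩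
    rw [this, Finset.sum_singleton]
    simp only [hF]
    rw [varthetaEnd_zero]
  have e1 : ∑ k, ∑ n ∈ S.lenLE t, F k n = (∑ k, ∑ n ∈ S.lenLE t with n = 0, F k n)
      + ∑ k, ∑ n ∈ S.lenLE t with ¬n = 0, F k n := by
    rw [← Finset.sum_add_distrib]
    exact Finset.sum_congr rfl fun k _ => (Finset.sum_filter_add_sum_filter_not _ _ _).symm
  have e2 : ∑ j, ∑ n ∈ S.lenLE t, F j n = (∑ j, ∑ n ∈ S.lenLE t with t < S.len n + S.L j, F j n)
      + ∑ j, ∑ n ∈ S.lenLE t with ¬t < S.len n + S.L j, F j n := by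
    rw [← Finset.sum_add_distrib]
    exact Finset.sum_congr rfl fun k _ => (Finset.sum_filter_add_sum_filter_not _ _ _).symm
  linarith

/-- The floor counts full turns on circle `j`; as its argument is nonnegative, the integer and
natural floors agree. -/
theorem fracMod_eq {n : Fin N → ℕ} {j : Fin N} {t : ℝ} (hn : S.len n ≤ t) :
    fracMod (t - S.len n) (S.L j)
      = t - S.len (n + Pi.single j ⌊(t - S.len n) / S.L j⌋₊) := by
  have h : 0 ≤ (t - S.len n) / S.L j := div_nonneg (sub_nonneg.2 hn) (S.L_pos j).le
  rw [fracMod, len_add, len_single, ← natCast_floor_eq_intCast_floor h]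
  ring

/-- The multi-indices `n` with `t - Lⱼ < L(n) ≤ t` are parametrized by those with `nⱼ = 0` and
`L(n) ≤ t`. -/
theorem sum_indices_eq (j : Fin N) (t : ℝ) (f : (Fin N → ℕ) → ℝ) :
    ∑ n ∈ S.indices j t, f (n + Pi.single j ⌊(t - S.len n) / S.L j⌋₊)
      = ∑ n ∈ S.lenLE t with t < S.len n + S.L j, f n := by
  have hL := S.L_pos j
  have hup : ∀ n : Fin N → ℕ, Function.update n j 0 + Pi.single j (n j) = n := by
    intro n
    funext k
    rcases eq_or_ne k j with rfl | hk
    · simp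
    · simp [hk]
  -- Given the other entries of `n`, the condition `t - L_j < L(n) ≤ t` determines `n_j`, and the
  -- floor is that value.
  refine Finset.sum_bij' (fun n _ => n + Pi.single j ⌊(t - S.len n) / S.L j⌋₊)
    (fun n _ => Function.update n j 0) ?_ ?_ ?_ ?_ fun _ _ => rfl
  · intro n hn
    obtain ⟨h0, hn⟩ := mem_indices.1 hn
    have h : 0 ≤ (t - S.len n) / S.L j := div_nonneg (sub_nonneg.2 hn) hL.le
    have h1 := Nat.floor_le h
    have h2 := Nat.lt_floor_add_one ((t - S.len n) / S.L j)
    rw [le_div_iff₀ hL] at h1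
    rw [div_lt_iff₀ hL] at h2
    simp only [Finset.mem_filter, mem_lenLE]
    rw [len_add, len_single]
    constructor <;> linarith
  · intro n hn
    simp only [Finset.mem_filter, mem_lenLE] at hn
    have h := S.len_add (Function.update n j 0) (Pi.single j (n j))
    rw [hup, len_single] at h
    have : 0 ≤ (n j : ℝ) * S.L j := by positivity
    exact mem_indices.2 ⟨by simp, by linarith [hn.1]⟩
  · intro n hn
    obtain ⟨h0, hn⟩ := mem_indices.1 hn
    funext k
    rcases eq_or_ne k j with rfl | hk
    · simp [h0]
    · simp [hk]
  · intro n hn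
    simp only [Finset.mem_filter, mem_lenLE] at hn
    have h := S.len_add (Function.update n j 0) (Pi.single j (n j))
    rw [hup, len_single] at h
    have hfl : ⌊(t - S.len (Function.update n j 0)) / S.L j⌋₊ = n j := by
      have hpos : 0 ≤ (t - S.len (Function.update n j 0)) / S.L j := by
        refine div_nonneg ?_ hL.le
        have : 0 ≤ (n j : ℝ) * S.L j := by positivity
        linarith [hn.1]
      rw [Nat.floor_eq_iff hpos, le_div_iff₀ hL, div_lt_iff₀ hL]
      constructor <;> linarith [hn.1, hn.2]
    rw [hfl, hup]

/-- The constraint `r ≥ 0` becomes the maximum with `L_j - (t - L(n))`, and `r ≤ t - L(n)` is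
redundant because `b ≤ L`. -/
theorem flowDamp_sub_len {j : Fin N} {n : Fin N → ℕ} {t : ℝ} :
    S.flowDamp j (t - S.len n) (S.L j) = S.damp j n (S.L j - (t - S.len n)) t := by
  have hb := S.b_le_all j
  have hset : Icc 0 (t - S.len n) ∩ Icc (t - S.len n - S.L j + S.a j) (t - S.len n - S.L j + S.b j)
      = Icc (t - S.len n - S.L j + max (S.L j - (t - S.len n)) (S.a j))
        (t - S.len n - S.L j + S.b j) := by
    rw [← max_add_add_left, show t - S.len n - S.L j + (S.L j - (t - S.len n)) = 0 by ring]
    ext r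
    simp only [mem_inter_iff, mem_Icc, max_le_iff]
    constructor
    · rintro ⟨⟨h1, h2⟩, h3, h4⟩
      exact ⟨⟨h1, h3⟩, h4⟩
    · rintro ⟨⟨h1, h2⟩, h3⟩
      exact ⟨⟨h1, by linarith⟩, h2, h3⟩
  rw [flowDamp, damp, hset]

/-- When a full turn fits, `L_j - (t - L(n)) ≤ 0 ≤ a_j`, so both maxima equal `a_j`. -/
theorem flowDamp_sub_len_of_add_le {j : Fin N} {n : Fin N → ℕ} {t : ℝ} (h : S.len n + S.L j ≤ t) :
    S.flowDamp j (t - S.len n) (S.L j) = S.damp j n 0 t := by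
  have ha := S.a_nonneg_all j
  rw [flowDamp_sub_len, damp, damp, max_eq_right ha,
    max_eq_right (by linarith)]

/-! ### The representation of the boundary values -/

variable {p : ℝ≥0∞} [Fact (1 ≤ p)]

theorem IsRegularSolution.eval_zero_eq_sum {z₀ : S.X p} {z : ℝ → S.X p}
    (hz : IsRegularSolution z₀ z) (i : Fin N) {t : ℝ} (ht : 0 ≤ t) :
    eval (z t) i 0
      = ∑ j : Fin N, ∑ n ∈ S.indices j t,
          S.vartheta i j (n + Pi.single j ⌊(t - S.len n) / S.L j⌋₊)
              (S.L j - fracMod (t - S.len n) (S.L j)) t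
            * eval z₀ j (S.L j - fracMod (t - S.len n) (S.L j)) := by
  have hbd : ∀ s, 0 ≤ s → ∀ k, eval (z s) k 0 = ∑ j, S.M k j * eval (z s) j (S.L j) :=
    fun s hs => (hz.mem_domain s hs).2
  -- The path expansion is applied to the end values `u_j(t - L(n), L_j)`; its hypothesis is one
  -- full turn followed by the transmission condition.
  have hsum := sum_varthetaEnd_mul i ht (fun n j => eval (z (t - S.len n)) j (S.L j)) (by
    intro j n hn
    have hL := S.L_pos j
    rw [hz.eval_of_ge j hL.le (by linarith) le_rfl, flowDamp_sub_len_of_add_le hn, mul_comm,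
      hbd _ (by linarith), len_add, len_single, Nat.cast_one, one_mul, sub_sub])
  rw [len_zero, sub_zero, ← hbd t ht] at hsum
  rw [← hsum]
  refine Finset.sum_congr rfl fun j _ => ?_
  set G : (Fin N → ℕ) → ℝ := fun m => S.vartheta i j m (S.L j - (t - S.len m)) t
    * eval z₀ j (S.L j - (t - S.len m)) with hG
  have hF : ∀ n ∈ S.indices j t, S.vartheta i j (n + Pi.single j ⌊(t - S.len n) / S.L j⌋₊)
        (S.L j - fracMod (t - S.len n) (S.L j)) t
          * eval z₀ j (S.L j - fracMod (t - S.len n) (S.L j))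
      = G (n + Pi.single j ⌊(t - S.len n) / S.L j⌋₊) := by
    intro n hn
    simp only [hG, fracMod_eq (mem_indices.1 hn).2]
  refine Eq.trans ?_ ((Finset.sum_congr rfl hF).trans (sum_indices_eq j t G)).symm
  refine Finset.sum_congr rfl fun n hn => ?_
  simp only [Finset.mem_filter, mem_lenLE] at hn
  -- At a terminal index `0 ≤ t - L(n) < L_j`, so the characteristic ending at `L_j` started from
  -- the initial datum.
  rw [hz.eval_of_le j (by linarith) (by linarith) le_rfl, flowDamp_sub_len]
  simp only [hG, vartheta]
  ring

end CircleNetwork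

end

theorem theorem3p4 {N : ℕ} (S : CircleNetwork N) (p : ℝ≥0∞) [Fact (1 ≤ p)] (hp : p ≠ ⊤)
    (z₀ : S.X p) (hz₀ : CircleNetwork.MemDomA z₀) (z : ℝ → S.X p)
    (hz : CircleNetwork.IsRegularSolution z₀ z) :
    (∀ i : Fin N, ∀ t x : ℝ, 0 ≤ t → x ∈ Icc 0 (S.L i) →
      (t ≤ x → CircleNetwork.eval (z t) i x
        = CircleNetwork.eval z₀ i (x - t) * S.flowDamp i t x) ∧
      (x ≤ t → CircleNetwork.eval (z t) i x
        = CircleNetwork.eval (z (t - x)) i 0 * S.flowDamp i t x)) ∧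
    (∀ i : Fin N, ∀ t : ℝ, 0 ≤ t →
      CircleNetwork.eval (z t) i 0
        = ∑ j : Fin N, ∑ n ∈ S.indices j t,
            S.vartheta i j (n + Pi.single j ⌊(t - S.len n) / S.L j⌋₊)
                (S.L j - CircleNetwork.fracMod (t - S.len n) (S.L j)) t
              * CircleNetwork.eval z₀ j
                  (S.L j - CircleNetwork.fracMod (t - S.len n) (S.L j))) := by
  refine ⟨fun i t x ht hx => ⟨fun htx => hz.eval_of_le i ht htx hx.2,
    fun hxt => hz.eval_of_ge i hx.1 hxt hx.2⟩, fun i t ht => hz.eval_zero_eq_sum i ht⟩
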